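/- **Setting.** Call a morphism *surjective* (written $\twoheadrightarrow$) if it factors through no proper subobject of its target, and *injective* if it is a monomorphism. A category $\mathcal A$ is *regular* if every morphism has an image (a least subobject of the target through which it factors), there is a terminal object, the pullback of a cospan exists whenever the cospan can be completed to a commutative square, and pullbacks of surjective morphisms along arbitrary morphisms exist and are surjective. It is *subobject finite* if each object has finitely many subobjects, *Mal'tsev* if every relation $r\subseteq x\times x$ containing the diagonal is an equivalence relation, and *exact* if every equivalence relation $r\subseteq x\times x$ is of the form $r=x\times_yx$ for a surjective morphism $x\twoheadrightarrow y$. A *degree function* $\delta$ on $\mathcal A$ with values in a commutative ring $K$ assigns to each surjective morphism $e$ an element $\delta(e)\in K$ such that $\delta(\mathrm{id}_x)=1$, $\delta(\bar e)=\delta(e)$ whenever $\bar e$ is a pullback of $e$, and $\delta(e\bar e)=\delta(e)\delta(\bar e)$ for composable $e,\bar e$. The category $\mathcal T^0=\mathcal T^0(\mathcal A,\delta)$ has an object $[x]$ for every object $x$ of $\mathcal A$; the morphisms $[x]\to[y]$ are the formal $K$-linear combinations of relations $\langle r\rangle$, i.e. of isomorphism classes of jointly injective pairs $x\leftarrow r\to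 y$, with bilinear composition $\langle s\rangle\langle r\rangle=\delta(r\times_ys\twoheadrightarrow s\circ r)\,\langle s\circ r\rangle$, where $s\circ r$ is the image of $r\times_ys$ in $x\times z$, and $\langle s\rangle\langle r\rangle=0$ if $r\times_ys$ does not exist. Let $\mathcal T$ be the pseudo-abelian closure of $\mathcal T^0$. For $f:x\to y$ let $[f]:[x]\to[y]$ be given by the graph of $f$ and $[f]^\vee:[y]\to[x]$ by its transpose. For a subobject $i:u\hookrightarrow x$ put $p_u=[i][i]^\vee$, let $p_x^*=\sum_{u\subseteq x}\mu(u,x)p_u$, where $\mu$ is the Möbius function of the poset of subobjects of $x$ (this is an idempotent), and let $[x]^*=p_x^*[x]$ be the corresponding direct summand of $[x]$ in $\mathcal T$. For a surjective $e:x\twoheadrightarrow y$ put $$\omega_e=\sum_{u\subseteq x,\ e(u)=y}\mu(u,x)\,\delta(u\twoheadrightarrow y)\in K .$$ A *co-relation* between $x$ and $y$ is an isomorphism class of diagrams $x\twoheadrightarrow u\twoheadleftarrow y$. Write $R_Q(x,y)$ for the set of co-relations, partially ordered by $u\le v$ if $x,y\twoheadrightarrow v$ factors through $x,y\twoheadrightarrow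 u$; it is finite if $\mathcal A$ is subobject finite, and $\mu_Q$ denotes its Möbius function. For $u\in R_Q(x,y)$ with legs $a:x\twoheadrightarrow u$ and $b:y\twoheadrightarrow u$ put $$\{u\}'=p_y^*\,[b]^\vee[a]\,p_x^*:\ [x]^*\to[y]^* .$$ **Lemma.** Let $\mathcal A$ be a subobject finite, exact Mal'tsev regular category, and let $\delta$ be a degree function on $\mathcal A$ with values in a commutative ring $K$. Let $u\in R_Q(x,y)$ and $v\in R_Q(y,z)$, and let $\bar y$ be the image of $y$ in $u\times v$. Then the pushout $w=u\sqcup_yv$ exists, the morphisms $u\to w$ and $v\to w$ are surjective (so that $w\in R_Q(u,v)$), $\bar y=u\times_wv$, and $$\{v\}'\,\{u\}'=\omega_{y\twoheadrightarrow\bar y}\sum_{t\in R_Q(u,v),\ t\le w}\mu_Q(t,w)\,\{t\}' ,$$ where on the right $t$ is regarded as an element of $R_Q(x,z)$ via $x\twoheadrightarrow u\twoheadrightarrow t\twoheadleftarrow v\twoheadleftarrow z$. -/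

import Mathlib

open CategoryTheory CategoryTheory.Limits

universe v u w

namespace TensorEnvelope

/-! ### Regular categories -/

section Basic

variable {A : Type u} [Category.{v} A]

/-- A morphism is surjective (an extremal epimorphism) if its image is the whole target, i.e.
every subobject of the target through which it factors is the target itself. -/
def Surj {x y : A} (f : x ⟶ y) : Prop :=
  ∀ ⦃z : A⦄ (g : x ⟶ z) (m : z ⟶ y) [Mono m], g ≫ m = f → IsIso m

variable (A) in
/-- A regular category: images exist, there is a terminal object, the pullback of a cospan exists
as soon as the cospan can be completed to a commutative square, and the pullback of a surjective
morphism along an arbitrary morphism exists and is surjective. Pullbacks are not required to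
exist in general. -/
class RegularCat : Prop where
  exists_image : ∀ {x y : A} (f : x ⟶ y), ∃ S : Subobject y, IsLeast {S | S.Factors f} S
  hasTerminal : HasTerminal A
  hasPullback : ∀ {u x y z : A} (p : u ⟶ x) (q : u ⟶ y) (f : x ⟶ z) (g : y ⟶ z),
    p ≫ f = q ≫ g → HasPullback f g
  surj_pullback : ∀ {x y z : A} (f : x ⟶ z) (g : y ⟶ z), Surj f →
    ∃ (r : A) (p : r ⟶ x) (q : r ⟶ y), IsPullback p q f g ∧ Surj q

/-- A pair of morphisms with a common source that is jointly injective. -/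
def JointlyMono {r x y : A} (p : r ⟶ x) (q : r ⟶ y) : Prop :=
  ∀ ⦃t : A⦄ (f g : t ⟶ r), f ≫ p = g ≫ p → f ≫ q = g ≫ q → f = g

/-! ### Relations -/

variable (A) in
/-- Representatives of relations between `x` and `y`: jointly injective pairs `x ← r → y`,
that is, monomorphisms into the product of `x` and `y` (whose existence is thus not needed
to speak about relations). -/
structure MonoSpan (x y : A) where
  obj : A
  fst : obj ⟶ x
  snd : obj ⟶ y
  jm : JointlyMono fst snd

/-- `r ≤ s` if `r` factors through `s`, as for monomorphisms into the product. -/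
instance (x y : A) : Preorder (MonoSpan A x y) where
  le r s := ∃ h : r.obj ⟶ s.obj, h ≫ s.fst = r.fst ∧ h ≫ s.snd = r.snd
  le_refl r := ⟨𝟙 _, by simp, by simp⟩
  le_trans r s t := by
    rintro ⟨h, h1, h2⟩ ⟨k, k1, k2⟩
    exact ⟨h ≫ k, by rw [Category.assoc, k1, h1], by rw [Category.assoc, k2, h2]⟩

/-- Relations between `x` and `y`, i.e. subobjects of the product of `x` and `y`: equivalence
classes of jointly injective pairs, with the induced partial order. -/
abbrev Rel (x y : A) : Type max u v := Antisymmetrization (MonoSpan A x y) (· ≤ ·)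

/-- The relation represented by a jointly injective pair. -/
abbrev MonoSpan.toRel {x y : A} (r : MonoSpan A x y) : Rel x y := toAntisymmetrization (· ≤ ·) r

/-- A chosen representative of a relation. -/
noncomputable abbrev Rel.rep {x y : A} (r : Rel x y) : MonoSpan A x y :=
  ofAntisymmetrization (· ≤ ·) r

/-- The relation given by the jointly injective pair `p, q : r ⟶ x` is an equivalence relation:
it is so on generalized elements. -/
def IsEquivRel {r x : A} (p q : r ⟶ x) : Prop :=
  JointlyMono p q ∧
    ∀ t : A, Equivalence fun f g : t ⟶ x => ∃ h : t ⟶ r, h ≫ p = f ∧ h ≫ q = g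

variable (A) in
/-- Every relation on an object `x` that contains the diagonal is an equivalence relation. -/
class Maltsev : Prop where
  isEquivRel : ∀ {x : A} (r : MonoSpan A x x),
    (∃ d : x ⟶ r.obj, d ≫ r.fst = 𝟙 x ∧ d ≫ r.snd = 𝟙 x) → IsEquivRel r.fst r.snd

variable (A) in
/-- Every equivalence relation is the kernel pair of a surjective morphism. -/
class ExactCat : Prop where
  exists_quotient : ∀ {r x : A} (p q : r ⟶ x), IsEquivRel p q →
    ∃ (y : A) (e : x ⟶ y), Surj e ∧ IsPullback p q e e

variable (A) in
/-- Every object has only finitely many subobjects. -/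
class SubobjectFinite : Prop where
  finite : ∀ x : A, Finite (Subobject x)

instance [SubobjectFinite A] (x : A) : Finite (Subobject x) := SubobjectFinite.finite x

lemma Surj.of_isIso {x y : A} (f : x ⟶ y) [IsIso f] : Surj f := by
  intro z g m _ h
  have : IsSplitEpi m := ⟨⟨⟨inv f ≫ g, by simp [h]⟩⟩⟩
  exact isIso_of_mono_of_isSplitEpi m

lemma Surj.id (x : A) : Surj (𝟙 x) := Surj.of_isIso _

lemma Surj.of_comp {x y z : A} {f : x ⟶ y} {g : y ⟶ z} (h : Surj (f ≫ g)) : Surj g := by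
  intro t k m _ hk
  exact h (f ≫ k) m (by simp [hk])

variable [RegularCat A]

instance : HasTerminal A := RegularCat.hasTerminal

lemma exists_isPullback {t x y z : A} {p : t ⟶ x} {q : t ⟶ y} {f : x ⟶ z} {g : y ⟶ z}
    (h : p ≫ f = q ≫ g) :
    ∃ (r : A) (a : r ⟶ x) (b : r ⟶ y) (k : t ⟶ r), IsPullback a b f g ∧ k ≫ a = p ∧ k ≫ b = q := by
  have := RegularCat.hasPullback p q f g h
  exact ⟨_, _, _, pullback.lift p q h, IsPullback.of_hasPullback f g,
    pullback.lift_fst _ _ _, pullback.lift_snd _ _ _⟩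

lemma Surj.lift_mono {t x y z : A} {e : t ⟶ x} (he : Surj e) (m : y ⟶ z) [Mono m]
    (f : x ⟶ z) (g : t ⟶ y) (h : e ≫ f = g ≫ m) : ∃ k : x ⟶ y, k ≫ m = f := by
  obtain ⟨r, a, b, k, hp, h1, h2⟩ := exists_isPullback h
  have : Mono a := hp.mono_fst_of_mono
  have := he k a h1
  exact ⟨inv a ≫ b, by rw [Category.assoc, ← hp.w]; simp⟩

lemma hasBinaryProduct_of_cone {t x y : A} (p : t ⟶ x) (q : t ⟶ y) : HasBinaryProduct x y := by
  obtain ⟨r, a, b, k, hp, -, -⟩ := exists_isPullback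
    (show p ≫ terminal.from x = q ≫ terminal.from y from Subsingleton.elim _ _)
  exact HasLimit.mk ⟨BinaryFan.mk a b, isProductOfIsTerminalIsPullback
    (terminal.from x) (terminal.from y) a b terminalIsTerminal hp.isLimit⟩

lemma Surj.epi {x y : A} {f : x ⟶ y} (hf : Surj f) : Epi f := by
  refine ⟨fun {z} p q h => ?_⟩
  have := hasBinaryProduct_of_cone (𝟙 z) (𝟙 z)
  obtain ⟨k, hk⟩ := hf.lift_mono (prod.lift (𝟙 z) (𝟙 z)) (prod.lift p q) (f ≫ p)
    (by ext <;> simp [h])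
  have h1 := congr($hk ≫ prod.fst)
  have h2 := congr($hk ≫ prod.snd)
  simp only [Category.assoc, prod.lift_fst, prod.lift_snd] at h1 h2
  rw [← h1, ← h2]

lemma Surj.comp {x y z : A} {f : x ⟶ y} {g : y ⟶ z} (hf : Surj f) (hg : Surj g) :
    Surj (f ≫ g) := by
  intro t k m _ hk
  obtain ⟨l, hl⟩ := hf.lift_mono m g k hk.symm
  exact hg l m hl

lemma Surj.of_isPullback {r x y z : A} {p : r ⟶ x} {q : r ⟶ y} {f : x ⟶ z} {g : y ⟶ z}
    (h : IsPullback p q f g) (hf : Surj f) : Surj q := by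
  obtain ⟨r', p', q', h', hq⟩ := RegularCat.surj_pullback f g hf
  have : q = (h.isoIsPullback _ _ h').hom ≫ q' := by simp
  rw [this]
  exact (Surj.of_isIso _).comp hq

/-- The universal property of surjections against jointly injective pairs. -/
lemma Surj.lift_jm {t i j x y : A} {e : t ⟶ i} (he : Surj e) {a : i ⟶ x} {b : i ⟶ y}
    {c : j ⟶ x} {d : j ⟶ y} (hj : JointlyMono c d) (g : t ⟶ j) (h1 : g ≫ c = e ≫ a)
    (h2 : g ≫ d = e ≫ b) : ∃ k : i ⟶ j, k ≫ c = a ∧ k ≫ d = b := by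
  have := hasBinaryProduct_of_cone a b
  have : Mono (prod.lift c d) := ⟨fun f g h => hj f g
    (by simpa [prod.lift_fst] using h =≫ prod.fst) (by simpa [prod.lift_snd] using h =≫ prod.snd)⟩
  obtain ⟨k, hk⟩ := he.lift_mono (prod.lift c d) (prod.lift a b) g (by ext <;> simp [h1, h2])
  exact ⟨k, by simpa [prod.lift_fst] using hk =≫ prod.fst, by simpa [prod.lift_snd] using hk =≫ prod.snd⟩

lemma exists_factor {x y : A} (f : x ⟶ y) :
    ∃ (i : A) (e : x ⟶ i) (m : i ⟶ y), Surj e ∧ Mono m ∧ e ≫ m = f := by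
  obtain ⟨S, hS, hmin⟩ := RegularCat.exists_image f
  refine ⟨_, S.factorThru f hS, S.arrow, ?_, inferInstance, by simp⟩
  intro z g m _ h
  have h1 : S ≤ Subobject.mk (m ≫ S.arrow) := hmin
    ((Subobject.factors_iff _ _).2 ⟨g ≫ (Subobject.underlyingIso (m ≫ S.arrow)).inv, by
      change (g ≫ _) ≫ (Subobject.mk (m ≫ S.arrow)).arrow = f
      simp only [Category.assoc, Subobject.underlyingIso_arrow]
      rw [← Category.assoc, h]; simp⟩)
  have : IsSplitEpi m := by
    refine ⟨⟨⟨Subobject.ofLEMk S (m ≫ S.arrow) h1, ?_⟩⟩⟩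
    rw [← cancel_mono S.arrow]
    simp
  exact isIso_of_mono_of_isSplitEpi m

/-- The image of the pair `x ← t → y` induced by `f` and `g`, i.e. the image of `t` in the product
of `x` and `y`. -/
lemma exists_spanImage {t x y : A} (f : t ⟶ x) (g : t ⟶ y) :
    ∃ (r : MonoSpan A x y) (e : t ⟶ r.obj), Surj e ∧ e ≫ r.fst = f ∧ e ≫ r.snd = g := by
  have := hasBinaryProduct_of_cone f g
  obtain ⟨i, e, m, he, hm, h⟩ := exists_factor (prod.lift f g)
  refine ⟨⟨i, m ≫ prod.fst, m ≫ prod.snd, fun t a b h1 h2 => ?_⟩, e, he, ?_, ?_⟩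
  · rw [← cancel_mono m]
    ext <;> simpa
  · simpa [prod.lift_fst] using h =≫ prod.fst
  · simpa [prod.lift_snd] using h =≫ prod.snd

/-- The image in the product of `x` and `y` of an object `t` equipped with morphisms to
`x` and `y`. -/
noncomputable def spanImage {t x y : A} (f : t ⟶ x) (g : t ⟶ y) : MonoSpan A x y :=
  (exists_spanImage f g).choose

/-- The surjection of an object onto its image in the product. -/
noncomputable def toSpanImage {t x y : A} (f : t ⟶ x) (g : t ⟶ y) : t ⟶ (spanImage f g).obj :=
  (exists_spanImage f g).choose_spec.choose

lemma toSpanImage_surj {t x y : A} (f : t ⟶ x) (g : t ⟶ y) : Surj (toSpanImage f g) :=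
  (exists_spanImage f g).choose_spec.choose_spec.1

lemma toSpanImage_fst {t x y : A} (f : t ⟶ x) (g : t ⟶ y) :
    toSpanImage f g ≫ (spanImage f g).fst = f :=
  (exists_spanImage f g).choose_spec.choose_spec.2.1

lemma toSpanImage_snd {t x y : A} (f : t ⟶ x) (g : t ⟶ y) :
    toSpanImage f g ≫ (spanImage f g).snd = g :=
  (exists_spanImage f g).choose_spec.choose_spec.2.2

end Basic

/-! ### Degree functions -/

/-- A degree function on `A` with values in `K`. -/
structure DegreeFunction (A : Type u) [Category.{v} A] (K : Type w) [CommRing K] where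
  deg : ∀ {x y : A} (e : x ⟶ y), Surj e → K
  deg_id : ∀ (x : A) (h : Surj (𝟙 x)), deg (𝟙 x) h = 1
  deg_pullback : ∀ {r x y z : A} {p : r ⟶ x} {q : r ⟶ y} {f : x ⟶ z} {g : y ⟶ z},
    IsPullback p q f g → ∀ (hf : Surj f) (hq : Surj q), deg q hq = deg f hf
  deg_comp : ∀ {x y z : A} (f : x ⟶ y) (g : y ⟶ z) (hf : Surj f) (hg : Surj g)
    (hfg : Surj (f ≫ g)), deg (f ≫ g) hfg = deg f hf * deg g hg

section T0

variable {A : Type u} [Category.{v} A] {K : Type w} [CommRing K]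

lemma DegreeFunction.deg_iso (δ : DegreeFunction A K) {x y : A} (f : x ⟶ y) [IsIso f]
    (h : Surj f) : δ.deg f h = 1 := by
  rw [← δ.deg_id y (Surj.id y)]
  exact δ.deg_pullback (IsPullback.of_vert_isIso (fst := f) (f := 𝟙 y) (g := 𝟙 y) ⟨by simp⟩) _ _

variable [RegularCat A] (δ : DegreeFunction A K)

/-- The multiple `δ (t ↠ i) ⟨i⟩` of the basis element of the image `i` of `t` in the product of
`x` and `y`. -/
noncomputable def spanHom {t x y : A} (f : t ⟶ x) (g : t ⟶ y) : Rel x y →₀ K :=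
  Finsupp.single (spanImage f g).toRel (δ.deg (toSpanImage f g) (toSpanImage_surj f g))

open Classical in
/-- The product of the basis elements of two relations `r` and `s`: it is
`δ (r ×_y s ↠ s ∘ r) ⟨s ∘ r⟩` if the fibre product `r ×_y s` exists, where `s ∘ r` is its image in
the product of `x` and `z`, and zero otherwise. -/
noncomputable def relComp {x y z : A} (r : Rel x y) (s : Rel y z) : Rel x z →₀ K :=
  if _h : HasPullback r.rep.snd s.rep.fst then
    spanHom δ (pullback.fst r.rep.snd s.rep.fst ≫ r.rep.fst)
      (pullback.snd r.rep.snd s.rep.fst ≫ s.rep.snd)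
  else 0

/-- The bilinear extension of `relComp` to linear combinations of relations. -/
noncomputable def compHom (x y z : A) :
    (Rel x y →₀ K) →ₗ[K] (Rel y z →₀ K) →ₗ[K] (Rel x z →₀ K) :=
  Finsupp.linearCombination K fun r => Finsupp.linearCombination K fun s => relComp δ r s

lemma compHom_single {x y z : A} (r : Rel x y) (s : Rel y z) (k l : K) :
    compHom δ x y z (Finsupp.single r k) (Finsupp.single s l) = (k * l) • relComp δ r s := by
  simp [compHom, mul_smul]

lemma spanHom_eq_single {t x y : A} (r : MonoSpan A x y) (e : t ⟶ r.obj) (he : Surj e) :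
    spanHom δ (e ≫ r.fst) (e ≫ r.snd) = Finsupp.single r.toRel (δ.deg e he) := by
  have h1 := toSpanImage_fst (e ≫ r.fst) (e ≫ r.snd)
  have h2 := toSpanImage_snd (e ≫ r.fst) (e ≫ r.snd)
  have hs := toSpanImage_surj (e ≫ r.fst) (e ≫ r.snd)
  change Finsupp.single (spanImage (e ≫ r.fst) (e ≫ r.snd)).toRel
    (δ.deg (toSpanImage (e ≫ r.fst) (e ≫ r.snd)) hs) = _
  generalize toSpanImage (e ≫ r.fst) (e ≫ r.snd) = e' at *
  generalize spanImage (e ≫ r.fst) (e ≫ r.snd) = r' at *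
  obtain ⟨k, k1, k2⟩ := he.lift_jm r'.jm e' h1 h2
  obtain ⟨l, l1, l2⟩ := hs.lift_jm r.jm e h1.symm h2.symm
  have hkl : k ≫ l = 𝟙 _ := r.jm _ _ (by simp [*]) (by simp [*])
  have hlk : l ≫ k = 𝟙 _ := r'.jm _ _ (by simp [*]) (by simp [*])
  have : IsIso k := ⟨l, hkl, hlk⟩
  have hek : e ≫ k = e' := r'.jm _ _ (by simp [*]) (by simp [*])
  have hr : r'.toRel = r.toRel := Quotient.sound ⟨⟨l, l1, l2⟩, ⟨k, k1, k2⟩⟩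
  subst hek
  rw [hr, δ.deg_comp e k he (Surj.of_isIso k), δ.deg_iso k, mul_one]

lemma spanHom_mono {x y : A} (r : MonoSpan A x y) :
    spanHom δ r.fst r.snd = Finsupp.single r.toRel 1 := by
  have := spanHom_eq_single δ r (𝟙 _) (Surj.id _)
  rwa [Category.id_comp, Category.id_comp, δ.deg_id] at this

/-- Every pair of morphisms factors through the chosen representative of its image. -/
lemma exists_rep {t x y : A} (f : t ⟶ x) (g : t ⟶ y) :
    ∃ (R : Rel x y) (e : t ⟶ R.rep.obj) (he : Surj e), e ≫ R.rep.fst = f ∧ e ≫ R.rep.snd = g ∧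
      spanHom δ f g = Finsupp.single R (δ.deg e he) := by
  obtain ⟨r, e, he, rfl, rfl⟩ := exists_spanImage f g
  have hr : (r.toRel.rep).toRel = r.toRel := toAntisymmetrization_ofAntisymmetrization _ _
  obtain ⟨⟨l, l1, l2⟩, ⟨k, k1, k2⟩⟩ := Quotient.exact hr
  have hkl : k ≫ l = 𝟙 _ := r.jm _ _ (by simp [*]) (by simp [*])
  have hlk : l ≫ k = 𝟙 _ := r.toRel.rep.jm _ _ (by simp [*]) (by simp [*])
  have : IsIso k := ⟨l, hkl, hlk⟩
  refine ⟨r.toRel, e ≫ k, he.comp (Surj.of_isIso k), by simp [*], by simp [*], ?_⟩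
  rw [spanHom_eq_single δ r e he, δ.deg_comp e k he (Surj.of_isIso k), δ.deg_iso k, mul_one]

lemma pullback_map_surj {t t' r s y p₁ p₂ : A} {e : t ⟶ r} {e' : t' ⟶ s} (he : Surj e)
    (he' : Surj e') {b : r ⟶ y} {c : s ⟶ y} {p : p₁ ⟶ t} {q : p₁ ⟶ t'} {P : p₂ ⟶ r} {Q : p₂ ⟶ s}
    (h₁ : IsPullback p q (e ≫ b) (e' ≫ c)) (h₂ : IsPullback P Q b c) (m : p₁ ⟶ p₂)
    (hP : m ≫ P = p ≫ e) (hQ : m ≫ Q = q ≫ e') :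
    ∃ hm : Surj m, δ.deg m hm = δ.deg e he * δ.deg e' he' := by
  obtain ⟨M, i, j, hM, hj⟩ := RegularCat.surj_pullback e' Q he'
  -- `M` is the fibre product of `r` and `t'`
  have hM' : IsPullback (j ≫ P) i b (e' ≫ c) := hM.flip.paste_horiz h₂
  have hw : p ≫ e ≫ b = q ≫ e' ≫ c := h₁.w
  obtain ⟨n, n1, n2⟩ : ∃ n : p₁ ⟶ M, n ≫ (j ≫ P) = p ≫ e ∧ n ≫ i = q :=
    ⟨hM'.lift (p ≫ e) q (by simpa using hw), by simp, by simp⟩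
  have hn : IsPullback p n e (j ≫ P) := by
    refine IsPullback.of_bot ?_ n1.symm hM'
    rw [n2]; exact h₁
  have hns : Surj n := Surj.of_isPullback hn he
  have hnm : n ≫ j = m := h₂.hom_ext (by simp [n1, hP]) (by simp [← hM.w, hQ, ← n2])
  subst hnm
  refine ⟨hns.comp hj, ?_⟩
  rw [δ.deg_comp n j hns hj, δ.deg_pullback hn he, δ.deg_pullback hM he']

lemma spanHom_precomp {t' t x y : A} (e : t' ⟶ t) (he : Surj e) (f : t ⟶ x) (g : t ⟶ y) :
    spanHom δ (e ≫ f) (e ≫ g) = δ.deg e he • spanHom δ f g := by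
  obtain ⟨r, k, hk, rfl, rfl⟩ := exists_spanImage f g
  rw [← Category.assoc, ← Category.assoc, spanHom_eq_single δ r _ (he.comp hk),
    spanHom_eq_single δ r _ hk, δ.deg_comp e k he hk]
  simp

lemma compHom_spanHom {t t' x y z p₀ : A} (f : t ⟶ x) (g : t ⟶ y) (f' : t' ⟶ y) (g' : t' ⟶ z)
    {p : p₀ ⟶ t} {q : p₀ ⟶ t'} (h : IsPullback p q g f') :
    compHom δ x y z (spanHom δ f g) (spanHom δ f' g') = spanHom δ (p ≫ f) (q ≫ g') := by
  obtain ⟨R, e, he, rfl, rfl, h1⟩ := exists_rep δ f g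
  obtain ⟨S, e', he', rfl, rfl, h2⟩ := exists_rep δ f' g'
  have hp := RegularCat.hasPullback (p ≫ e) (q ≫ e') R.rep.snd S.rep.fst (by simpa using h.w)
  rw [h1, h2, compHom_single, relComp, dif_pos hp]
  obtain ⟨hm, hd⟩ := pullback_map_surj δ he he' h (IsPullback.of_hasPullback R.rep.snd S.rep.fst)
    (pullback.lift (p ≫ e) (q ≫ e') (by simpa using h.w))
    (pullback.lift_fst _ _ _) (pullback.lift_snd _ _ _)
  rw [← hd, ← spanHom_precomp]
  simp only [pullback.lift_fst_assoc, pullback.lift_snd_assoc, Category.assoc]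

lemma compHom_spanHom_zero {t t' x y z : A} (f : t ⟶ x) (g : t ⟶ y) (f' : t' ⟶ y) (g' : t' ⟶ z)
    (h : ¬ HasPullback g f') : compHom δ x y z (spanHom δ f g) (spanHom δ f' g') = 0 := by
  obtain ⟨R, e, he, rfl, rfl, h1⟩ := exists_rep δ f g
  obtain ⟨S, e', he', rfl, rfl, h2⟩ := exists_rep δ f' g'
  rw [h1, h2, compHom_single, relComp, dif_neg, smul_zero]
  intro hp
  apply h
  obtain ⟨M, i, j, hM, -⟩ := RegularCat.surj_pullback e (pullback.fst R.rep.snd S.rep.fst) he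
  obtain ⟨N, i', j', hN, -⟩ :=
    RegularCat.surj_pullback e' (j ≫ pullback.snd R.rep.snd S.rep.fst) he'
  refine RegularCat.hasPullback (j' ≫ i) i' _ _ ?_
  have := pullback.condition (f := R.rep.snd) (g := S.rep.fst)
  have h3 := hM.w
  have h4 := hN.w
  calc (j' ≫ i) ≫ e ≫ R.rep.snd = j' ≫ (i ≫ e) ≫ R.rep.snd := by simp
    _ = (j' ≫ j ≫ pullback.snd R.rep.snd S.rep.fst) ≫ S.rep.fst := by
      rw [h3, Category.assoc, Category.assoc, Category.assoc, this]
    _ = i' ≫ e' ≫ S.rep.fst := by rw [← h4]; simp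

lemma compHom_assoc_span {t₁ t₂ t₃ x y z w : A} (f₁ : t₁ ⟶ x) (g₁ : t₁ ⟶ y) (f₂ : t₂ ⟶ y)
    (g₂ : t₂ ⟶ z) (f₃ : t₃ ⟶ z) (g₃ : t₃ ⟶ w) :
    compHom δ x z w (compHom δ x y z (spanHom δ f₁ g₁) (spanHom δ f₂ g₂)) (spanHom δ f₃ g₃) =
      compHom δ x y w (spanHom δ f₁ g₁) (compHom δ y z w (spanHom δ f₂ g₂) (spanHom δ f₃ g₃)) := by
  by_cases h : ∃ (c : A) (c₁ : c ⟶ t₁) (c₂ : c ⟶ t₂) (c₃ : c ⟶ t₃),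
      c₁ ≫ g₁ = c₂ ≫ f₂ ∧ c₂ ≫ g₂ = c₃ ≫ f₃
  · obtain ⟨c, c₁, c₂, c₃, h1, h2⟩ := h
    obtain ⟨r, a, b, k, hr, hk1, hk2⟩ := exists_isPullback h1
    obtain ⟨s, a', b', k', hs, hk1', hk2'⟩ := exists_isPullback h2
    obtain ⟨m, a'', b'', k'', hm, -, -⟩ := exists_isPullback (hk2.trans hk1'.symm)
    rw [compHom_spanHom δ _ _ _ _ hr, compHom_spanHom δ _ _ _ _ hs,
      compHom_spanHom δ _ _ _ _ (hm.flip.paste_horiz hs.flip).flip,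
      compHom_spanHom δ _ _ _ _ (hm.paste_horiz hr)]
    simp
  · have hl : compHom δ x z w (compHom δ x y z (spanHom δ f₁ g₁) (spanHom δ f₂ g₂))
        (spanHom δ f₃ g₃) = 0 := by
      by_cases hp : HasPullback g₁ f₂
      · rw [compHom_spanHom δ _ _ _ _ (IsPullback.of_hasPullback g₁ f₂)]
        refine compHom_spanHom_zero δ _ _ _ _ fun hq => h ?_
        refine ⟨_, pullback.fst _ _ ≫ pullback.fst g₁ f₂, pullback.fst _ _ ≫ pullback.snd g₁ f₂,
          pullback.snd (pullback.snd g₁ f₂ ≫ g₂) f₃, ?_, ?_⟩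
        · simp [pullback.condition]
        · simpa using pullback.condition
      · rw [compHom_spanHom_zero δ _ _ _ _ hp]; simp
    have hr : compHom δ x y w (spanHom δ f₁ g₁)
        (compHom δ y z w (spanHom δ f₂ g₂) (spanHom δ f₃ g₃)) = 0 := by
      by_cases hp : HasPullback g₂ f₃
      · rw [compHom_spanHom δ _ _ _ _ (IsPullback.of_hasPullback g₂ f₃)]
        refine compHom_spanHom_zero δ _ _ _ _ fun hq => h ?_
        refine ⟨_, pullback.fst g₁ (pullback.fst g₂ f₃ ≫ f₂),
          pullback.snd _ _ ≫ pullback.fst g₂ f₃, pullback.snd _ _ ≫ pullback.snd g₂ f₃, ?_, ?_⟩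
        · simpa using pullback.condition
        · simp [pullback.condition]
      · rw [compHom_spanHom_zero δ _ _ _ _ hp]; simp
    rw [hl, hr]

/-- Linear combinations of relations are spanned by the elements `spanHom`. -/
lemma hom_induction {x y : A} {P : (Rel x y →₀ K) → Prop} (φ : Rel x y →₀ K) (h0 : P 0)
    (hadd : ∀ φ ψ, P φ → P ψ → P (φ + ψ)) (hsmul : ∀ (k : K) φ, P φ → P (k • φ))
    (hspan : ∀ {t : A} (f : t ⟶ x) (g : t ⟶ y), P (spanHom δ f g)) : P φ := by
  induction φ using Finsupp.induction_linear with
  | zero => exact h0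
  | add φ ψ h1 h2 => exact hadd _ _ h1 h2
  | single r k =>
    have : Finsupp.single r k = k • spanHom δ r.rep.fst r.rep.snd := by
      rw [spanHom_mono δ r.rep]
      simp [MonoSpan.toRel, Rel.rep]
    rw [this]
    exact hsmul _ _ (hspan _ _)

lemma compHom_assoc {x y z w : A} (φ : Rel x y →₀ K) (ψ : Rel y z →₀ K) (χ : Rel z w →₀ K) :
    compHom δ x z w (compHom δ x y z φ ψ) χ = compHom δ x y w φ (compHom δ y z w ψ χ) := by
  induction φ using hom_induction δ with
  | h0 => simp
  | hadd φ φ' h h' => simp [h, h']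
  | hsmul k φ h => simp [h]
  | hspan f g =>
    induction ψ using hom_induction δ with
    | h0 => simp
    | hadd φ φ' h h' => simp [h, h']
    | hsmul k φ h => simp [h]
    | hspan f' g' =>
      induction χ using hom_induction δ with
      | h0 => simp
      | hadd φ φ' h h' => simp [h, h']
      | hsmul k φ h => simp [h]
      | hspan f'' g'' => exact compHom_assoc_span δ _ _ _ _ _ _

/-- The graph of a morphism. -/
def graph {x y : A} (f : x ⟶ y) : MonoSpan A x y where
  obj := x
  fst := 𝟙 x
  snd := f
  jm _ _ _ h _ := by simpa using h

/-- The adjoint of the graph of a morphism. -/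
def graphAdj {x y : A} (f : x ⟶ y) : MonoSpan A y x where
  obj := x
  fst := f
  snd := 𝟙 x
  jm _ _ _ _ h := by simpa using h

lemma id_compHom {x y : A} (φ : Rel x y →₀ K) :
    compHom δ x x y (Finsupp.single (graph (𝟙 x)).toRel 1) φ = φ := by
  rw [← spanHom_mono δ]
  induction φ using hom_induction δ with
  | h0 => simp
  | hadd φ φ' h h' => simp [h, h']
  | hsmul k φ h => simp [h]
  | hspan f g =>
    exact (compHom_spanHom δ _ _ _ _ (IsPullback.id_horiz f).flip).trans (by simp [graph])

lemma compHom_id {x y : A} (φ : Rel x y →₀ K) :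
    compHom δ x y y φ (Finsupp.single (graph (𝟙 y)).toRel 1) = φ := by
  rw [← spanHom_mono δ]
  induction φ using hom_induction δ with
  | h0 => simp
  | hadd φ φ' h h' => simp [h, h']
  | hsmul k φ h => simp [h]
  | hspan f g =>
    exact (compHom_spanHom δ _ _ _ _ (IsPullback.id_horiz g)).trans (by simp [graph])

/-! ### The category `T⁰` -/

lemma compHom_add_left {x y z : A} (φ φ' : Rel x y →₀ K) (ψ : Rel y z →₀ K) :
    compHom δ x y z (φ + φ') ψ = compHom δ x y z φ ψ + compHom δ x y z φ' ψ := by simp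

lemma compHom_add_right {x y z : A} (φ : Rel x y →₀ K) (ψ ψ' : Rel y z →₀ K) :
    compHom δ x y z φ (ψ + ψ') = compHom δ x y z φ ψ + compHom δ x y z φ ψ' := by simp

lemma compHom_smul_left {x y z : A} (k : K) (φ : Rel x y →₀ K) (ψ : Rel y z →₀ K) :
    compHom δ x y z (k • φ) ψ = k • compHom δ x y z φ ψ := by simp

lemma compHom_smul_right {x y z : A} (φ : Rel x y →₀ K) (k : K) (ψ : Rel y z →₀ K) :
    compHom δ x y z φ (k • ψ) = k • compHom δ x y z φ ψ := by simp

/-- The objects of the category `T⁰` attached to the degree function `δ` are those of `A`. -/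
structure T0 (δ : DegreeFunction A K) where
  of : A

/-- Morphisms of `T⁰` are formal linear combinations of relations; they are composed by
`compHom`, and the identities are the diagonals. -/
noncomputable instance : Category (T0 δ) where
  Hom X Y := Rel X.of Y.of →₀ K
  id X := Finsupp.single (graph (𝟙 X.of)).toRel 1
  comp {X Y Z} φ ψ := compHom δ X.of Y.of Z.of φ ψ
  id_comp φ := id_compHom δ φ
  comp_id φ := compHom_id δ φ
  assoc φ ψ χ := compHom_assoc δ φ ψ χ

noncomputable instance : Preadditive (T0 δ) where
  homGroup X Y := inferInstanceAs (AddCommGroup (Rel X.of Y.of →₀ K))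
  add_comp X Y Z := @compHom_add_left A _ K _ _ δ X.of Y.of Z.of
  comp_add X Y Z := @compHom_add_right A _ K _ _ δ X.of Y.of Z.of

noncomputable instance : Linear K (T0 δ) where
  homModule X Y := inferInstanceAs (Module K (Rel X.of Y.of →₀ K))
  smul_comp X Y Z := @compHom_smul_left A _ K _ _ δ X.of Y.of Z.of
  comp_smul X Y Z := @compHom_smul_right A _ K _ _ δ X.of Y.of Z.of

/-- The object `[x]` of `T⁰`. -/
abbrev T0.obj (x : A) : T0 δ := ⟨x⟩

/-- The morphism `⟨r⟩ : [x] ⟶ [y]` of a relation `r`. -/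
noncomputable def T0.rel {x y : A} (r : Rel x y) : T0.obj δ x ⟶ T0.obj δ y :=
  Finsupp.single r (1 : K)

/-- The morphism `[f] : [x] ⟶ [y]`. -/
noncomputable def T0.map {x y : A} (f : x ⟶ y) : T0.obj δ x ⟶ T0.obj δ y :=
  T0.rel δ (graph f).toRel

/-- The morphism `[f]^∨ : [y] ⟶ [x]`. -/
noncomputable def T0.mapAdj {x y : A} (f : x ⟶ y) : T0.obj δ y ⟶ T0.obj δ x :=
  T0.rel δ (graphAdj f).toRel

end T0

/-! ### Möbius functions and the idempotents `p_x^*` -/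

open Classical in
/-- The Möbius function of a finite partially ordered set. -/
noncomputable def mobius {α : Type*} [PartialOrder α] [Finite α] (a b : α) : ℤ :=
  letI : Fintype α := Fintype.ofFinite α
  letI : LocallyFiniteOrder α := Fintype.toLocallyFiniteOrder
  IncidenceAlgebra.mu ℤ a b

section Mobius

variable {α : Type*} [PartialOrder α] [Fintype α]

lemma mobius_self (a : α) : mobius a a = 1 := by
  classical
  let _ : LocallyFiniteOrder α := @Fintype.toLocallyFiniteOrder α _ (Fintype.ofFinite α) _ _
  exact IncidenceAlgebra.mu_self (𝕜 := ℤ) a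

open Classical in
lemma sum_mobius_left (a b : α) :
    ∑ u : α, (if a ≤ u ∧ u ≤ b then mobius u b else 0) = if a = b then 1 else 0 := by
  let _ : LocallyFiniteOrder α := @Fintype.toLocallyFiniteOrder α _ (Fintype.ofFinite α) _ _
  rw [← IncidenceAlgebra.sum_Icc_mu_left (𝕜 := ℤ) a b, ← Finset.sum_filter]
  refine Finset.sum_congr (by ext; simp) fun u _ => rfl

open Classical in
/-- Weisner's theorem, for a partial order in which only the pairs with a common lower bound are
required to have a meet. -/
lemma sum_mobius_meet [OrderTop α]
    (hm : ∀ a b c : α, c ≤ a → c ≤ b → ∃ m, IsGLB {a, b} m) (v : α) (hv : v ≠ ⊤) (w : α) :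
    ∑ u : α, (if IsGLB {u, v} w then mobius u ⊤ else 0) = 0 := by
  induction w using WellFoundedGT.induction with
  | ind w ih =>
    by_cases hw : w ≤ v
    · have h1 : ∑ w' : α, (if w ≤ w' then
          ∑ u : α, (if IsGLB {u, v} w' then mobius u ⊤ else 0) else 0) = 0 := by
        have hne : w ≠ ⊤ := fun h => hv (top_le_iff.1 (h ▸ hw))
        have h2 := sum_mobius_left w (⊤ : α)
        rw [if_neg hne] at h2
        refine Eq.trans ?_ h2
        have : ∀ w' : α, (if w ≤ w' then
            ∑ u : α, (if IsGLB {u, v} w' then mobius u ⊤ else 0) else 0) =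
            ∑ u : α, if w ≤ w' ∧ IsGLB {u, v} w' then mobius u ⊤ else 0 := by
          intro w'
          by_cases h : w ≤ w'
          · rw [if_pos h]
            exact Finset.sum_congr rfl fun u _ => by simp only [h, true_and]
          · rw [if_neg h]
            exact (Finset.sum_eq_zero fun u _ => if_neg fun h' => h h'.1).symm
        rw [Finset.sum_congr rfl fun w' _ => this w', Finset.sum_comm]
        refine Finset.sum_congr rfl fun u _ => ?_
        by_cases hu : w ≤ u
        · obtain ⟨m, hmm⟩ := hm u v w hu hw
          have hwm : w ≤ m := hmm.2 (by rintro _ (rfl | rfl) <;> assumption)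
          rw [if_pos ⟨hu, le_top⟩, Finset.sum_eq_single m]
          · rw [if_pos ⟨hwm, hmm⟩]
          · intro w' _ hne'
            rw [if_neg fun h => hne' (h.2.unique hmm)]
          · simp
        · rw [if_neg fun h => hu h.1]
          refine Finset.sum_eq_zero fun w' _ => if_neg fun h => hu (h.1.trans (h.2.1 (by simp)))
      rw [Finset.sum_eq_single w] at h1
      · simpa using h1
      · intro w' _ hne
        by_cases h : w ≤ w'
        · rw [if_pos h]; exact ih w' (lt_of_le_of_ne h hne.symm)
        · rw [if_neg h]
      · simp
    · refine Finset.sum_eq_zero fun u _ => if_neg fun h => hw (h.1 (by simp))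

end Mobius

section Star

variable {A : Type u} [Category.{v} A] [RegularCat A] {K : Type w} [CommRing K]
  (δ : DegreeFunction A K)

/-- The idempotent `p_u = [i] [i]^∨` of the subobject `i : u ⟶ x`. -/
noncomputable def proj {x : A} (u : Subobject x) : T0.obj δ x ⟶ T0.obj δ x :=
  T0.mapAdj δ u.arrow ≫ T0.map δ u.arrow

lemma proj_eq_spanHom {x : A} (u : Subobject x) : proj δ u = spanHom δ u.arrow u.arrow := by
  have h1 : T0.mapAdj δ u.arrow = spanHom δ u.arrow (𝟙 _) :=
    (spanHom_mono δ (graphAdj u.arrow)).symm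
  have h2 : T0.map δ u.arrow = spanHom δ (𝟙 _) u.arrow :=
    (spanHom_mono δ (graph u.arrow)).symm
  rw [proj, h1, h2]
  exact (compHom_spanHom δ _ _ _ _ (IsPullback.id_horiz (𝟙 _))).trans (by simp)

lemma proj_top {x : A} : proj δ (⊤ : Subobject x) = 𝟙 _ := by
  rw [proj_eq_spanHom]
  have := spanHom_precomp δ (⊤ : Subobject x).arrow (Surj.of_isIso _) (𝟙 x) (𝟙 x)
  rw [Category.comp_id, δ.deg_iso, one_smul] at this
  rw [this]
  exact spanHom_mono δ (graph (𝟙 x))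

lemma spanHom_eq_proj {x y : A} (f : y ⟶ x) [Mono f] :
    spanHom δ f f = proj δ (Subobject.mk f) := by
  rw [proj_eq_spanHom]
  have := spanHom_precomp δ (Subobject.underlyingIso f).inv (Surj.of_isIso _)
    (Subobject.mk f).arrow (Subobject.mk f).arrow
  rwa [δ.deg_iso, one_smul, Subobject.underlyingIso_arrow] at this

lemma hasPullback_of_le {x : A} {u v c : Subobject x} (hu : c ≤ u) (hv : c ≤ v) :
    HasPullback u.arrow v.arrow :=
  RegularCat.hasPullback (Subobject.ofLE c u hu) (Subobject.ofLE c v hv) _ _ (by simp)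

lemma exists_meet {x : A} (u v : Subobject x) (h : HasPullback u.arrow v.arrow) :
    ∃ m : Subobject x, IsGLB {u, v} m ∧ proj δ u ≫ proj δ v = proj δ m := by
  have hp := IsPullback.of_hasPullback u.arrow v.arrow
  have : Mono (pullback.fst u.arrow v.arrow) := hp.mono_fst_of_mono
  refine ⟨Subobject.mk (pullback.fst u.arrow v.arrow ≫ u.arrow), ⟨?_, ?_⟩, ?_⟩
  · rintro _ (rfl | rfl)
    · exact Subobject.mk_le_of_comm (pullback.fst _ _) rfl
    · exact Subobject.mk_le_of_comm (pullback.snd _ _) pullback.condition.symm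
  · intro c hc
    have hu : c ≤ u := hc (by simp)
    have hv : c ≤ v := hc (by simp)
    refine Subobject.le_mk_of_comm
      (hp.lift (Subobject.ofLE c u hu) (Subobject.ofLE c v hv) (by simp)) ?_
    rw [← Category.assoc, hp.lift_fst, Subobject.ofLE_arrow]
  · rw [← spanHom_eq_proj, proj_eq_spanHom, proj_eq_spanHom]
    refine (compHom_spanHom δ _ _ _ _ hp).trans ?_
    rw [hp.w]

lemma proj_comp_zero {x : A} (u v : Subobject x) (h : ¬ HasPullback u.arrow v.arrow) :
    proj δ u ≫ proj δ v = 0 := by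
  rw [proj_eq_spanHom, proj_eq_spanHom]
  exact compHom_spanHom_zero δ _ _ _ _ h

lemma map_comp_mapAdj {r x y u : A} {p : r ⟶ x} {q : r ⟶ y} {a : x ⟶ u} {b : y ⟶ u}
    (h : IsPullback p q a b) : T0.map δ a ≫ T0.mapAdj δ b = spanHom δ p q := by
  have h1 : T0.map δ a = spanHom δ (𝟙 _) a := (spanHom_mono δ (graph a)).symm
  have h2 : T0.mapAdj δ b = spanHom δ b (𝟙 _) := (spanHom_mono δ (graphAdj b)).symm
  rw [h1, h2]
  exact (compHom_spanHom δ _ _ _ _ h).trans (by simp)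

variable [SubobjectFinite A]

/-- The idempotent `p_x^* = ∑_{u ⊆ x} μ(u, x) p_u`. -/
noncomputable def pStar (x : A) : T0.obj δ x ⟶ T0.obj δ x :=
  ∑ᶠ u : Subobject x, mobius u ⊤ • proj δ u

lemma pStar_comp_proj {x : A} (v : Subobject x) (hv : v ≠ ⊤) : pStar δ x ≫ proj δ v = 0 := by
  classical
  have : Fintype (Subobject x) := Fintype.ofFinite _
  have key : ∀ u : Subobject x, proj δ u ≫ proj δ v =
      ∑ w : Subobject x, if IsGLB {u, v} w then proj δ w else 0 := by
    intro u
    by_cases h : HasPullback u.arrow v.arrow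
    · obtain ⟨m, hm, hp⟩ := exists_meet δ u v h
      rw [hp, Finset.sum_eq_single m]
      · rw [if_pos hm]
      · intro w _ hw
        exact if_neg fun h => hw (h.unique hm)
      · simp
    · rw [proj_comp_zero δ u v h]
      refine (Finset.sum_eq_zero fun w _ => if_neg fun hw => h ?_).symm
      exact hasPullback_of_le (hw.1 (by simp)) (hw.1 (by simp))
  have hmeet : ∀ a b c : Subobject x, c ≤ a → c ≤ b → ∃ m, IsGLB {a, b} m := by
    intro a b c ha hb
    obtain ⟨m, hm, -⟩ := exists_meet δ a b (hasPullback_of_le ha hb)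
    exact ⟨m, hm⟩
  rw [pStar, finsum_eq_sum_of_fintype, Preadditive.sum_comp]
  simp_rw [Preadditive.zsmul_comp, key, Finset.smul_sum]
  rw [Finset.sum_comm]
  refine Finset.sum_eq_zero fun w _ => ?_
  have := sum_mobius_meet hmeet v hv w
  have h0 := congrArg (fun n : ℤ => n • proj δ w) this
  simp only [zero_smul, Finset.sum_smul] at h0
  refine Eq.trans (Finset.sum_congr rfl fun u _ => ?_) h0
  by_cases h : IsGLB {u, v} w <;> simp [h]

lemma pStar_idem (x : A) : pStar δ x ≫ pStar δ x = pStar δ x := by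
  classical
  have : Fintype (Subobject x) := Fintype.ofFinite _
  have h : pStar δ x = ∑ u : Subobject x, mobius u ⊤ • proj δ u := finsum_eq_sum_of_fintype _
  conv_lhs => arg 2; rw [h]
  rw [Preadditive.comp_sum, Finset.sum_eq_single ⊤]
  · rw [Preadditive.comp_zsmul, mobius_self, one_smul, proj_top, Category.comp_id]
  · intro v _ hv
    rw [Preadditive.comp_zsmul, pStar_comp_proj δ v hv, smul_zero]
  · simp

end Star

/-! ### The pseudo-abelian category `T` -/

section Karoubi

open Idempotents

variable {K : Type w} [CommRing K] {C : Type*} [Category C] [Preadditive C] [Linear K C]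

instance (P Q : Karoubi C) : SMul K (P ⟶ Q) where
  smul k f := ⟨k • f.f, by
    rw [Linear.smul_comp, Linear.comp_smul, f.comm]⟩

@[simp] lemma karoubi_smul_f {P Q : Karoubi C} (k : K) (f : P ⟶ Q) : (k • f).f = k • f.f := rfl

instance (P Q : Karoubi C) : Module K (P ⟶ Q) where
  one_smul f := by ext; simp
  mul_smul a b f := by ext; simp [mul_smul]
  smul_zero a := by ext; simp
  smul_add a f g := by ext; simp
  add_smul a b f := by ext; simp [add_smul]
  zero_smul f := by ext; simp

end Karoubi

/-! ### Co-relations -/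

section Corel

variable {A : Type u} [Category.{v} A]

variable (A) in
/-- Representatives of co-relations: diagrams `x ↠ u ↞ y`. -/
structure Cospan (x y : A) where
  obj : A
  left : x ⟶ obj
  right : y ⟶ obj
  surj_left : Surj left
  surj_right : Surj right

/-- `u ≤ v` if the pair `x ↠ v ↞ y` factors through the pair `x ↠ u ↞ y`. -/
instance (x y : A) : Preorder (Cospan A x y) where
  le u v := ∃ h : u.obj ⟶ v.obj, u.left ≫ h = v.left ∧ u.right ≫ h = v.right
  le_refl u := ⟨𝟙 _, by simp, by simp⟩
  le_trans u v w := by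
    rintro ⟨h, h1, h2⟩ ⟨k, k1, k2⟩
    exact ⟨h ≫ k, by rw [← Category.assoc, h1, k1], by rw [← Category.assoc, h2, k2]⟩

/-- The partially ordered set of co-relations between `x` and `y`, i.e. of isomorphism classes of
diagrams `x ↠ u ↞ y` (see `Cospan.toCorel_eq_iff`). -/
abbrev Corel (x y : A) : Type max u v := Antisymmetrization (Cospan A x y) (· ≤ ·)

/-- The co-relation represented by a diagram `x ↠ u ↞ y`. -/
abbrev Cospan.toCorel {x y : A} (u : Cospan A x y) : Corel x y := toAntisymmetrization (· ≤ ·) u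

/-- A chosen representative of a co-relation. -/
noncomputable abbrev Corel.rep {x y : A} (u : Corel x y) : Cospan A x y :=
  ofAntisymmetrization (· ≤ ·) u

variable [RegularCat A]

lemma Cospan.toCorel_eq_iff {x y : A} (u v : Cospan A x y) :
    u.toCorel = v.toCorel ↔
      ∃ i : u.obj ≅ v.obj, u.left ≫ i.hom = v.left ∧ u.right ≫ i.hom = v.right := by
  constructor
  · intro h
    obtain ⟨⟨h, h1, h2⟩, ⟨k, k1, k2⟩⟩ := Quotient.exact h
    have := u.surj_left.epi
    have := v.surj_left.epi
    refine ⟨⟨h, k, ?_, ?_⟩, h1, h2⟩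
    · rw [← cancel_epi u.left, ← Category.assoc, h1, k1, Category.comp_id]
    · rw [← cancel_epi v.left, ← Category.assoc, k1, h1, Category.comp_id]
  · rintro ⟨i, h1, h2⟩
    exact Quotient.sound ⟨⟨i.hom, h1, h2⟩, ⟨i.inv, by simp [← h1], by simp [← h2]⟩⟩

/-- A diagram `u ↠ t ↞ v` regarded as a diagram `x ↠ t ↞ z` via surjections `x ↠ u` and
`z ↠ v`. -/
def Cospan.extend {x z u v : A} (t : Cospan A u v) (a : x ⟶ u) (d : z ⟶ v) (ha : Surj a)
    (hd : Surj d) : Cospan A x z where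
  obj := t.obj
  left := a ≫ t.left
  right := d ≫ t.right
  surj_left := ha.comp t.surj_left
  surj_right := hd.comp t.surj_right

/-- A surjective morphism is the quotient by its kernel pair. -/
lemma Surj.exists_desc {x y z : A} {a : x ⟶ y} (ha : Surj a) (g : x ⟶ z)
    (h : ∀ ⦃t : A⦄ (p q : t ⟶ x), p ≫ a = q ≫ a → p ≫ g = q ≫ g) : ∃ k : y ⟶ z, a ≫ k = g := by
  obtain ⟨r, e, he, h1, h2⟩ := exists_spanImage a g
  have : Mono r.fst := by
    refine ⟨fun {t} s s' hs => r.jm _ _ hs ?_⟩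
    obtain ⟨t₁, p₁, q₁, hp₁, hq₁⟩ := RegularCat.surj_pullback e s he
    obtain ⟨t₂, p₂, q₂, hp₂, hq₂⟩ := RegularCat.surj_pullback e (q₁ ≫ s') he
    have := (hq₂.comp hq₁).epi
    have w1 : p₁ ≫ e = q₁ ≫ s := hp₁.w
    have w2 : p₂ ≫ e = q₂ ≫ q₁ ≫ s' := hp₂.w
    have e1 : (q₂ ≫ p₁) ≫ e = (q₂ ≫ q₁) ≫ s := by simp [w1]
    have e2 : p₂ ≫ e = (q₂ ≫ q₁) ≫ s' := by simp [w2]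
    have key := h (q₂ ≫ p₁) p₂ (by
      rw [← h1, ← Category.assoc, ← Category.assoc, e1, e2, Category.assoc, hs, ← Category.assoc])
    rw [← h2, ← Category.assoc, ← Category.assoc, e1, e2, Category.assoc, Category.assoc _ s'] at key
    exact (cancel_epi _).1 key
  have : IsIso r.fst := ha e r.fst h1
  exact ⟨inv r.fst ≫ r.snd, by rw [← h2, ← h1]; simp⟩

/-- The fibre product of `x` and `y` over `u`, as a relation. -/
lemma Cospan.exists_fiberProduct {x y : A} (u : Cospan A x y) :
    ∃ r : MonoSpan A x y, IsPullback r.fst r.snd u.left u.right := by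
  obtain ⟨r, p, q, h, -⟩ := RegularCat.surj_pullback u.left u.right u.surj_left
  exact ⟨⟨r, p, q, fun t f g h1 h2 => h.hom_ext h1 h2⟩, h⟩

lemma Cospan.le_of_fiberProduct_le {x y : A} {u v : Cospan A x y} {r s : MonoSpan A x y}
    (hr : IsPullback r.fst r.snd u.left u.right) (hs : IsPullback s.fst s.snd v.left v.right)
    (h : r ≤ s) : u ≤ v := by
  obtain ⟨l, l1, l2⟩ := h
  have hrel : ∀ {t : A} (p : t ⟶ x) (q : t ⟶ y), p ≫ u.left = q ≫ u.right →
      p ≫ v.left = q ≫ v.right := by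
    intro t p q hpq
    have h1 : hr.lift p q hpq ≫ r.fst = p := hr.lift_fst _ _ _
    have h2 : hr.lift p q hpq ≫ r.snd = q := hr.lift_snd _ _ _
    calc p ≫ v.left = hr.lift p q hpq ≫ l ≫ s.fst ≫ v.left := by
          rw [← Category.assoc l, l1, ← Category.assoc, h1]
      _ = q ≫ v.right := by rw [hs.w, ← Category.assoc l, l2, ← Category.assoc, h2]
  obtain ⟨k, hk⟩ := u.surj_left.exists_desc v.left (by
    intro t p q hpq
    obtain ⟨t', b, c, hb, hc⟩ := RegularCat.surj_pullback u.right (p ≫ u.left) u.surj_right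
    have := hc.epi
    have w : b ≫ u.right = c ≫ p ≫ u.left := hb.w
    have e1 := hrel (c ≫ p) b (by rw [w, Category.assoc])
    have e2 := hrel (c ≫ q) b (by rw [w, Category.assoc, hpq])
    rw [← cancel_epi c, ← Category.assoc, ← Category.assoc, e1, e2])
  refine ⟨k, hk, ?_⟩
  have := (Surj.of_isPullback hr u.surj_left).epi
  rw [← cancel_epi r.snd, ← Category.assoc, ← hr.w, Category.assoc, hk]
  exact hrel _ _ hr.w

instance [SubobjectFinite A] (x y : A) : Finite (Rel x y) := by
  rcases isEmpty_or_nonempty (Rel x y) with h | h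
  · infer_instance
  obtain ⟨r₁⟩ : Nonempty (MonoSpan A x y) := h.map Rel.rep
  have := hasBinaryProduct_of_cone r₁.fst r₁.snd
  have hm : ∀ r : MonoSpan A x y, Mono (prod.lift r.fst r.snd) := fun r =>
    ⟨fun f g h => r.jm f g (by simpa [prod.lift_fst] using h =≫ prod.fst)
      (by simpa [prod.lift_snd] using h =≫ prod.snd)⟩
  have hle : ∀ r s : MonoSpan A x y,
      Subobject.mk (prod.lift r.fst r.snd) ≤ Subobject.mk (prod.lift s.fst s.snd) → r ≤ s := by
    intro r s h
    have := Subobject.ofMkLEMk_comp h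
    exact ⟨Subobject.ofMkLEMk _ _ h, by simpa [prod.lift_fst] using this =≫ prod.fst,
      by simpa [prod.lift_snd] using this =≫ prod.snd⟩
  refine Finite.of_injective
    (fun r : Rel x y => Subobject.mk (prod.lift r.rep.fst r.rep.snd)) fun r s h => ?_
  rw [← toAntisymmetrization_ofAntisymmetrization (· ≤ ·) r,
    ← toAntisymmetrization_ofAntisymmetrization (· ≤ ·) s]
  exact Quotient.sound ⟨hle _ _ (le_of_eq h), hle _ _ (le_of_eq h.symm)⟩

instance [SubobjectFinite A] (x y : A) : Finite (Corel x y) := by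
  choose F hF using fun u : Cospan A x y => u.exists_fiberProduct
  refine Finite.of_injective (fun u : Corel x y => (F u.rep).toRel) fun u v h => ?_
  obtain ⟨h1, h2⟩ := Quotient.exact h
  rw [← toAntisymmetrization_ofAntisymmetrization (· ≤ ·) u,
    ← toAntisymmetrization_ofAntisymmetrization (· ≤ ·) v]
  exact Quotient.sound ⟨Cospan.le_of_fiberProduct_le (hF _) (hF _) h1,
    Cospan.le_of_fiberProduct_le (hF _) (hF _) h2⟩

end Corel

/-! ### The objects `[x]^*` and the morphisms `{u}'` -/

section Main

variable {A : Type u} [Category.{v} A] [RegularCat A] [SubobjectFinite A] {K : Type w} [CommRing K]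
  (δ : DegreeFunction A K)

/-- The direct summand `[x]^* = p_x^* [x]` of `[x]`, an object of the category of direct summands
of objects of `T⁰`. This is a full subcategory of the pseudo-abelian closure of `T⁰`; finite direct
sums are not needed. -/
noncomputable def starObj (x : A) : Idempotents.Karoubi (T0 δ) where
  X := T0.obj δ x
  p := pStar δ x
  idem := pStar_idem δ x

/-- The morphism `{u}' = p_y^* [b]^∨ [a] p_x^*` for a diagram `x ↠ u ↞ y` with legs `a` and `b`, as
a morphism `[x] ⟶ [y]` of `T⁰`. -/
noncomputable def corelHomT0 {x y : A} (u : Cospan A x y) : T0.obj δ x ⟶ T0.obj δ y :=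
  pStar δ x ≫ T0.map δ u.left ≫ T0.mapAdj δ u.right ≫ pStar δ y

lemma pStar_corelHomT0_pStar {x y : A} (u : Cospan A x y) :
    pStar δ x ≫ corelHomT0 δ u ≫ pStar δ y = corelHomT0 δ u := by
  simp only [corelHomT0, Category.assoc, pStar_idem]
  rw [← Category.assoc, pStar_idem]

/-- The morphism `{u}' : [x]^* ⟶ [y]^*` for a diagram `x ↠ u ↞ y`. -/
noncomputable def corelHom {x y : A} (u : Cospan A x y) : starObj δ x ⟶ starObj δ y where
  f := corelHomT0 δ u
  comm := pStar_corelHomT0_pStar δ u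

/-- The morphism `{u}'` depends only on the co-relation represented by `x ↠ u ↞ y`. -/
lemma corelHom_congr {x y : A} {u v : Cospan A x y} (h : u.toCorel = v.toCorel) :
    corelHom δ u = corelHom δ v := by
  obtain ⟨i, h1, h2⟩ := (Cospan.toCorel_eq_iff u v).1 h
  obtain ⟨r, hr⟩ := u.exists_fiberProduct
  have hr' : IsPullback r.fst r.snd v.left v.right :=
    hr.of_iso (Iso.refl _) (Iso.refl _) (Iso.refl _) i (by simp) (by simp) (by simp [h1])
      (by simp [h2])
  have := (map_comp_mapAdj δ hr).trans (map_comp_mapAdj δ hr').symm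
  refine Idempotents.Karoubi.hom_ext _ _ ?_
  change corelHomT0 δ u = corelHomT0 δ v
  rw [corelHomT0, corelHomT0, ← Category.assoc (T0.map δ u.left), this, Category.assoc]

open Classical in
/-- The invariant `ω_e = ∑_{e(u) = y} μ(u, x) δ(u ↠ y)` of a surjective morphism `e : x ⟶ y`, where
`u` runs through the subobjects of `x` that are mapped onto `y`. -/
noncomputable def omega {x y : A} (e : x ⟶ y) : K :=
  ∑ᶠ u : Subobject x, if h : Surj (u.arrow ≫ e) then mobius u ⊤ • δ.deg (u.arrow ≫ e) h else 0

end Main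

end TensorEnvelope

/-!
In a Mal'tsev category every relation is difunctional, so by exactness a relation with surjective
legs is the fibre product of a cospan, which is then also its pushout. Applied to the image `ȳ` of
`y` in `u × v` this gives the co-relation `w`; applied to the subobjects of `ȳ`, it identifies those
with surjective legs with the co-relations `t ≤ w`.

Since `[e] p_y^* [e]^∨ = ω_e p_ȳ^*` for `e : y ↠ ȳ`, the composite `{v}' {u}'` is `ω_e` times an
expression that is linear in `p_ȳ^* = ∑ μ(s, ȳ) p_s`. The subobjects `s` without surjective legs are
killed by `p_x^*` or `p_z^*`. The others form an upward closed set, so that their Möbius function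
can be computed among the co-relations below `w`.
-/

namespace TensorEnvelope

section Relations

variable {A : Type u} [Category.{v} A] {x y z : A}

/-- The generalized elements `f` of `x` and `g` of `y` are related by `r`: the pair `(f, g)` factors
through `r`. In particular `r ≤ s` means by definition that `s` relates `r.fst` and `r.snd`. -/
def MonoSpan.Relates (r : MonoSpan A x y) {t : A} (f : t ⟶ x) (g : t ⟶ y) : Prop :=
  ∃ h : t ⟶ r.obj, h ≫ r.fst = f ∧ h ≫ r.snd = g

lemma MonoSpan.relates_comp (r : MonoSpan A x y) {t : A} (h : t ⟶ r.obj) :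
    r.Relates (h ≫ r.fst) (h ≫ r.snd) :=
  ⟨h, rfl, rfl⟩

lemma MonoSpan.Relates.precomp {r : MonoSpan A x y} {s t : A} {f : t ⟶ x} {g : t ⟶ y}
    (h : r.Relates f g) (k : s ⟶ t) : r.Relates (k ≫ f) (k ≫ g) := by
  obtain ⟨l, rfl, rfl⟩ := h
  exact ⟨k ≫ l, Category.assoc _ _ _, Category.assoc _ _ _⟩

lemma MonoSpan.isPullback_iff_relates_iff (r : MonoSpan A x y) {a : x ⟶ z} {b : y ⟶ z} :
    IsPullback r.fst r.snd a b ↔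
      ∀ {t : A} (f : t ⟶ x) (g : t ⟶ y), r.Relates f g ↔ f ≫ a = g ≫ b := by
  refine ⟨fun h t f g => ⟨?_, fun hfg => ⟨h.lift f g hfg, h.lift_fst _ _ _, h.lift_snd _ _ _⟩⟩,
    fun h => ?_⟩
  · rintro ⟨l, rfl, rfl⟩
    rw [Category.assoc, h.w, Category.assoc]
  · choose lift lift_fst lift_snd using
      fun s : PullbackCone a b => (h s.fst s.snd).2 s.condition
    exact ⟨⟨(h _ _).1 (le_refl r)⟩, ⟨PullbackCone.IsLimit.mk _ lift lift_fst lift_snd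
      fun s m m_fst m_snd => r.jm _ _ (m_fst.trans (lift_fst s).symm)
        (m_snd.trans (lift_snd s).symm)⟩⟩

/-- A relation `r` is difunctional if `f r g`, `f' r g` and `f' r g'` imply `f r g'`. -/
def MonoSpan.IsDifunctional (r : MonoSpan A x y) : Prop :=
  ∀ ⦃t : A⦄ ⦃f f' : t ⟶ x⦄ ⦃g g' : t ⟶ y⦄,
    r.Relates f g → r.Relates f' g → r.Relates f' g' → r.Relates f g'

variable [RegularCat A]

lemma Surj.relates_precomp_iff {s t : A} {k : s ⟶ t} (hk : Surj k) {r : MonoSpan A x y}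
    {f : t ⟶ x} {g : t ⟶ y} : r.Relates (k ≫ f) (k ≫ g) ↔ r.Relates f g :=
  ⟨fun ⟨h, h_fst, h_snd⟩ => hk.lift_jm r.jm h h_fst h_snd, fun h => h.precomp k⟩

lemma MonoSpan.exists_inverseImage {x' y' t : A} (r : MonoSpan A x y) (a : x' ⟶ x) (b : y' ⟶ y)
    {f₀ : t ⟶ x'} {g₀ : t ⟶ y'} (h₀ : r.Relates (f₀ ≫ a) (g₀ ≫ b)) :
    ∃ s : MonoSpan A x' y',
      ∀ {t : A} (f : t ⟶ x') (g : t ⟶ y'), s.Relates f g ↔ r.Relates (f ≫ a) (g ≫ b) := by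
  obtain ⟨h, h_fst, h_snd⟩ := h₀
  obtain ⟨p, p₁, p₂, k, hp, -, hk⟩ := exists_isPullback h_fst.symm
  have hb : k ≫ p₂ ≫ r.snd = g₀ ≫ b := by rw [← h_snd, ← hk, Category.assoc]
  obtain ⟨q, q₁, q₂, -, hq, -, -⟩ := exists_isPullback hb
  refine ⟨⟨q, q₁ ≫ p₁, q₂, fun t f g h₁ h₂ => ?_⟩, fun f g => ⟨?_, ?_⟩⟩
  · have h₁' : (f ≫ q₁) ≫ p₁ = (g ≫ q₁) ≫ p₁ := by simpa only [Category.assoc] using h₁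
    refine hq.hom_ext (hp.hom_ext h₁' (r.jm _ _ ?_ ?_)) h₂
    · simp only [Category.assoc, ← hp.w, reassoc_of% h₁]
    · simp only [Category.assoc, hq.w, reassoc_of% h₂]
  · rintro ⟨l, rfl, rfl⟩
    exact ⟨l ≫ q₁ ≫ p₂, by simp only [Category.assoc, hp.w], by simp only [Category.assoc, hq.w]⟩
  · rintro ⟨l, hl₁, hl₂⟩
    exact ⟨hq.lift (hp.lift f l hl₁.symm) g (by rw [hp.lift_snd_assoc, hl₂]), by simp, by simp⟩

lemma MonoSpan.isDifunctional [Maltsev A] (r : MonoSpan A x y) : r.IsDifunctional := by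
  -- The pairs `(a, b)` of elements of `r` such that `a.fst r b.snd` form a reflexive relation.
  have diag : r.Relates (𝟙 r.obj ≫ r.fst) (𝟙 r.obj ≫ r.snd) := r.relates_comp _
  obtain ⟨s, hs⟩ := r.exists_inverseImage r.fst r.snd diag
  obtain ⟨-, s_equiv⟩ := Maltsev.isEquivRel s ((hs _ _).2 diag)
  rintro t _ _ _ _ ⟨a, rfl, rfl⟩ hba ⟨b, rfl, rfl⟩
  exact (hs a b).1 ((s_equiv t).symm ((hs b a).2 hba))

lemma MonoSpan.exists_transpose_comp (r : MonoSpan A x y) (s : MonoSpan A z y)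
    (h : HasPullback r.snd s.snd) :
    ∃ c : MonoSpan A x z, ∀ {t : A} (f : t ⟶ x) (g : t ⟶ z), c.Relates f g ↔
      ∃ (t' : A) (π : t' ⟶ t) (b : t' ⟶ y), Surj π ∧ r.Relates (π ≫ f) b ∧ s.Relates (π ≫ g) b := by
  have hp := IsPullback.of_hasPullback r.snd s.snd
  obtain ⟨c, e, he, e_fst, e_snd⟩ :=
    exists_spanImage (pullback.fst r.snd s.snd ≫ r.fst) (pullback.snd r.snd s.snd ≫ s.fst)
  refine ⟨c, fun f g => ⟨?_, ?_⟩⟩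
  · rintro ⟨k, rfl, rfl⟩
    obtain ⟨t', l, π, hl, hπ⟩ := RegularCat.surj_pullback e k he
    refine ⟨t', π, l ≫ pullback.fst r.snd s.snd ≫ r.snd, hπ,
      ⟨l ≫ pullback.fst _ _, ?_, Category.assoc _ _ _⟩, ⟨l ≫ pullback.snd _ _, ?_, ?_⟩⟩
    · rw [Category.assoc, ← e_fst, hl.w_assoc]
    · rw [Category.assoc, ← e_snd, hl.w_assoc]
    · rw [Category.assoc, hp.w]
  · rintro ⟨t', π, b, hπ, ⟨k, k_fst, rfl⟩, ⟨l, l_fst, l_snd⟩⟩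
    refine hπ.relates_precomp_iff.1 ⟨hp.lift k l l_snd.symm ≫ e, ?_, ?_⟩
    · rw [Category.assoc, e_fst, hp.lift_fst_assoc, k_fst]
    · rw [Category.assoc, e_snd, hp.lift_snd_assoc, l_fst]

/-- The Mal'tsev property makes `r° ∘ r` an equivalence relation on `x`. The relation `r` induces
a map from `y` to the quotient of `x`, and is the fibre product because it is difunctional. -/
lemma MonoSpan.exists_cospan_isPullback [ExactCat A] [Maltsev A] (r : MonoSpan A x y)
    (hfst : Surj r.fst) (hsnd : Surj r.snd) :
    ∃ w : Cospan A x y, IsPullback r.fst r.snd w.left w.right := by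
  obtain ⟨c, hc⟩ := r.exists_transpose_comp r (RegularCat.hasPullback (𝟙 _) (𝟙 _) _ _ rfl)
  have c_refl : c.Relates (𝟙 x) (𝟙 x) := by
    have h : r.Relates (r.fst ≫ 𝟙 x) r.snd := ⟨𝟙 _, by simp, by simp⟩
    exact (hc _ _).2 ⟨_, r.fst, r.snd, hfst, h, h⟩
  obtain ⟨q, e, he, h_ker⟩ := ExactCat.exists_quotient _ _ (Maltsev.isEquivRel c c_refl)
  have hce : ∀ {t : A} (f g : t ⟶ x), c.Relates f g ↔ f ≫ e = g ≫ e :=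
    c.isPullback_iff_relates_iff.1 h_ker
  obtain ⟨k, hk⟩ : ∃ k : y ⟶ q, r.snd ≫ k = r.fst ≫ e := by
    refine hsnd.exists_desc _ fun t f g hfg => ?_
    rw [← Category.assoc, ← Category.assoc, ← hce, hc]
    exact ⟨t, 𝟙 t, f ≫ r.snd, Surj.id t, ⟨f, by simp, rfl⟩, ⟨g, by simp, hfg.symm⟩⟩
  have k_surj : Surj k := Surj.of_comp (f := r.snd) (hk ▸ hfst.comp he)
  refine ⟨⟨q, e, k, he, k_surj⟩,
    (r.isPullback_iff_relates_iff (a := e) (b := k)).2 fun {t} f g => ⟨?_, fun hfg => ?_⟩⟩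
  · rintro ⟨l, rfl, rfl⟩
    rw [Category.assoc, Category.assoc, hk]
  · obtain ⟨t₁, l, π, hl, hπ⟩ := RegularCat.surj_pullback r.snd g hsnd
    have hcl : c.Relates (π ≫ f) (l ≫ r.fst) := by
      rw [hce, Category.assoc, Category.assoc, hfg, ← hk, hl.w_assoc]
    obtain ⟨t₂, ρ, b, hρ, hfb, hlb⟩ := (hc _ _).1 hcl
    have hlg : r.Relates (ρ ≫ l ≫ r.fst) (ρ ≫ π ≫ g) := hl.w ▸ (r.relates_comp l).precomp ρ
    exact hπ.relates_precomp_iff.1 (hρ.relates_precomp_iff.1 (r.isDifunctional hfb hlb hlg))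

lemma Cospan.isPushout_of_isPullback (w : Cospan A x y) {r : A} {p : r ⟶ x} {q : r ⟶ y}
    (h : IsPullback p q w.left w.right) : IsPushout p q w.left w.right := by
  have := w.surj_left.epi
  have := (Surj.of_isPullback h w.surj_left).epi
  have exists_desc : ∀ s : PushoutCocone p q,
      ∃ d : w.obj ⟶ s.pt, w.left ≫ d = s.inl ∧ w.right ≫ d = s.inr := by
    intro s
    obtain ⟨d, hd⟩ : ∃ d : w.obj ⟶ s.pt, w.left ≫ d = s.inl := by
      refine w.surj_left.exists_desc _ fun t f g hfg => ?_
      obtain ⟨t', b, π, hb, hπ⟩ := RegularCat.surj_pullback w.right (f ≫ w.left) w.surj_right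
      have inl_eq : ∀ f : t ⟶ x, b ≫ w.right = π ≫ f ≫ w.left → π ≫ f ≫ s.inl = b ≫ s.inr := by
        intro f hf
        have hlift : (π ≫ f) ≫ w.left = b ≫ w.right := by rw [hf, Category.assoc]
        rw [← h.lift_snd _ _ hlift, Category.assoc, ← s.condition, h.lift_fst_assoc, Category.assoc]
      have := hπ.epi
      rw [← cancel_epi π, inl_eq f hb.w, inl_eq g (hfg ▸ hb.w)]
    refine ⟨d, hd, ?_⟩
    rw [← cancel_epi q, ← h.w_assoc, hd, s.condition]
  choose d hd_left hd_right using exists_desc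
  exact ⟨⟨h.w⟩, ⟨PushoutCocone.IsColimit.mk _ d hd_left hd_right
    fun s m hm _ => (cancel_epi w.left).1 (hm.trans (hd_left s).symm)⟩⟩

end Relations

section Mobius

lemma mobius_orderEmbedding {α β : Type*} [PartialOrder α] [Finite α] [PartialOrder β] [Finite β]
    (f : α ↪o β) {a b : α} (hab : a ≤ b) (hf : Set.Icc (f a) (f b) ⊆ Set.range f) :
    mobius (f a) (f b) = mobius a b := by
  classical
  cases nonempty_fintype α
  cases nonempty_fintype β
  induction a using WellFoundedGT.induction with
  | ind a ih =>
    have sum_comp : ∑ u, (if a ≤ u ∧ u ≤ b then mobius (f u) (f b) else 0) =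
        ∑ s, if f a ≤ s ∧ s ≤ f b then mobius s (f b) else 0 :=
      Fintype.sum_of_injective f f.injective _ _ (fun s hs => if_neg fun h => hs (hf h))
        fun u => by simp only [f.le_iff_le]
    have sum_sub : ∑ u, ((if a ≤ u ∧ u ≤ b then mobius (f u) (f b) else 0) -
        if a ≤ u ∧ u ≤ b then mobius u b else 0) = 0 := by
      rw [Finset.sum_sub_distrib, sum_comp, sum_mobius_left, sum_mobius_left]
      simp only [f.injective.eq_iff, sub_self]
    rw [Finset.sum_eq_single a] at sum_sub
    · simpa only [le_rfl, hab, and_self, if_true, sub_eq_zero] using sum_sub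
    · intro u _ hu
      split_ifs with h
      · rw [sub_eq_zero]
        exact ih u (lt_of_le_of_ne h.1 hu.symm) h.2
          ((Set.Icc_subset_Icc_left (f.monotone h.1)).trans hf)
      · exact sub_self 0
    · exact fun h => absurd (Finset.mem_univ a) h

end Mobius

section FiberProducts

variable {A : Type u} [Category.{v} A] {x y z : A}

lemma MonoSpan.Relates.of_le {r s : MonoSpan A x y} {t : A} {f : t ⟶ x} {g : t ⟶ y}
    (h : r.Relates f g) (hrs : r ≤ s) : s.Relates f g := by
  obtain ⟨l, rfl, rfl⟩ := h
  exact MonoSpan.Relates.precomp hrs l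

lemma MonoSpan.isPullback_of_le_of_le {r s : MonoSpan A x y} (hrs : r ≤ s) (hsr : s ≤ r)
    {a : x ⟶ z} {b : y ⟶ z} (hr : IsPullback r.fst r.snd a b) : IsPullback s.fst s.snd a b := by
  rw [isPullback_iff_relates_iff] at hr ⊢
  exact fun f g => ⟨fun h => (hr f g).1 (h.of_le hsr), fun h => ((hr f g).2 h).of_le hrs⟩

lemma MonoSpan.surj_fst_of_le {r s : MonoSpan A x y} (hrs : r ≤ s) (hr : Surj r.fst) :
    Surj s.fst := by
  obtain ⟨h, h_fst, -⟩ := hrs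
  exact Surj.of_comp (f := h) (h_fst ▸ hr)

lemma MonoSpan.surj_snd_of_le {r s : MonoSpan A x y} (hrs : r ≤ s) (hr : Surj r.snd) :
    Surj s.snd := by
  obtain ⟨h, -, h_snd⟩ := hrs
  exact Surj.of_comp (f := h) (h_snd ▸ hr)

/-- A subobject `s` of (the object of) a relation `r`, regarded as a relation contained in `r`. -/
noncomputable def MonoSpan.restrict (r : MonoSpan A x y) (s : Subobject r.obj) :
    MonoSpan A x y where
  obj := (s : A)
  fst := s.arrow ≫ r.fst
  snd := s.arrow ≫ r.snd
  jm t f g h₁ h₂ := (cancel_mono s.arrow).1 (r.jm _ _ (by simpa using h₁) (by simpa using h₂))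

lemma MonoSpan.restrict_le (r : MonoSpan A x y) (s : Subobject r.obj) : r.restrict s ≤ r :=
  r.relates_comp s.arrow

lemma MonoSpan.restrict_le_restrict_iff {r : MonoSpan A x y} {s s' : Subobject r.obj} :
    r.restrict s ≤ r.restrict s' ↔ s ≤ s' := by
  constructor
  · rintro ⟨h, h_fst, h_snd⟩
    exact Subobject.le_of_comm h (r.jm _ _ ((Category.assoc _ _ _).trans h_fst)
      ((Category.assoc _ _ _).trans h_snd))
  · intro h
    exact ⟨Subobject.ofLE s s' h, by simp [restrict], by simp [restrict]⟩

lemma MonoSpan.exists_restrict_of_le {r s : MonoSpan A x y} (hsr : s ≤ r) :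
    ∃ m : Subobject r.obj, r.restrict m ≤ s ∧ s ≤ r.restrict m := by
  obtain ⟨h, h_fst, h_snd⟩ := hsr
  have : Mono h := ⟨fun f g hfg => s.jm _ _
    (by rw [← h_fst, reassoc_of% hfg]) (by rw [← h_snd, reassoc_of% hfg])⟩
  exact ⟨Subobject.mk h,
    ⟨(Subobject.underlyingIso h).hom, by simp [restrict, ← h_fst], by simp [restrict, ← h_snd]⟩,
    ⟨(Subobject.underlyingIso h).inv, by simp [restrict, h_fst], by simp [restrict, h_snd]⟩⟩

lemma Corel.rep_le_iff {t : Corel x y} {w : Cospan A x y} : t.rep ≤ w ↔ t ≤ w.toCorel := by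
  conv_rhs => rw [← toAntisymmetrization_ofAntisymmetrization (· ≤ ·) t]
  exact Iff.rfl

lemma Corel.le_rep_iff {t : Corel x y} {w : Cospan A x y} : w ≤ t.rep ↔ w.toCorel ≤ t := by
  conv_rhs => rw [← toAntisymmetrization_ofAntisymmetrization (· ≤ ·) t]
  exact Iff.rfl

variable [RegularCat A]

lemma Cospan.fiberProduct_le_iff {u v : Cospan A x y} {r s : MonoSpan A x y}
    (hr : IsPullback r.fst r.snd u.left u.right) (hs : IsPullback s.fst s.snd v.left v.right) :
    r ≤ s ↔ u ≤ v := by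
  refine ⟨Cospan.le_of_fiberProduct_le hr hs, ?_⟩
  rintro ⟨h, h_left, h_right⟩
  exact (s.isPullback_iff_relates_iff.1 hs _ _).2 (by rw [← h_left, ← h_right, hr.w_assoc])

variable {r : MonoSpan A x y} {w : Cospan A x y} (hr : IsPullback r.fst r.snd w.left w.right)

include hr in
lemma Cospan.exists_restrict_isPullback {t : Cospan A x y} (ht : t ≤ w) :
    ∃ s : Subobject r.obj,
      IsPullback (r.restrict s).fst (r.restrict s).snd t.left t.right := by
  obtain ⟨p, hp⟩ := t.exists_fiberProduct
  obtain ⟨s, hsp, hps⟩ := MonoSpan.exists_restrict_of_le ((fiberProduct_le_iff hp hr).2 ht)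
  exact ⟨s, MonoSpan.isPullback_of_le_of_le hps hsp hp⟩

/-- The fibre products of the co-relations below `w`, as subobjects of the fibre product `r`
of `w`. -/
noncomputable def Cospan.fiberSubobject : Set.Iic w.toCorel ↪o Subobject r.obj :=
  OrderEmbedding.ofMapLEIff
    (fun t => (exists_restrict_isPullback hr (Corel.rep_le_iff.2 t.2)).choose) fun t t' => by
      rw [← MonoSpan.restrict_le_restrict_iff,
        fiberProduct_le_iff (exists_restrict_isPullback hr (Corel.rep_le_iff.2 t.2)).choose_spec
          (exists_restrict_isPullback hr (Corel.rep_le_iff.2 t'.2)).choose_spec,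
        ofAntisymmetrization_le_ofAntisymmetrization_iff, Subtype.coe_le_coe]

lemma Cospan.isPullback_fiberSubobject (t : Set.Iic w.toCorel) :
    IsPullback (r.restrict (fiberSubobject hr t)).fst (r.restrict (fiberSubobject hr t)).snd
      t.1.rep.left t.1.rep.right :=
  (exists_restrict_isPullback hr (Corel.rep_le_iff.2 t.2)).choose_spec

lemma Cospan.fiberSubobject_top : fiberSubobject hr ⊤ = ⊤ := by
  rw [eq_top_iff, ← MonoSpan.restrict_le_restrict_iff]
  exact (r.restrict_le _).trans
    ((fiberProduct_le_iff hr (isPullback_fiberSubobject hr _)).2 (Corel.le_rep_iff.2 le_rfl))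

lemma Cospan.mem_range_fiberSubobject_iff [ExactCat A] [Maltsev A] {s : Subobject r.obj} :
    s ∈ Set.range (fiberSubobject hr) ↔ Surj (r.restrict s).fst ∧ Surj (r.restrict s).snd := by
  constructor
  · rintro ⟨t, rfl⟩
    have ht := isPullback_fiberSubobject hr t
    exact ⟨Surj.of_isPullback ht.flip t.1.rep.surj_right, Surj.of_isPullback ht t.1.rep.surj_left⟩
  · rintro ⟨hfst, hsnd⟩
    obtain ⟨t, ht⟩ := (r.restrict s).exists_cospan_isPullback hfst hsnd
    have ht_le : t ≤ w := le_of_fiberProduct_le ht hr (r.restrict_le s)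
    refine ⟨⟨t.toCorel, ht_le⟩, le_antisymm ?_ ?_⟩ <;> rw [← MonoSpan.restrict_le_restrict_iff]
    · exact (fiberProduct_le_iff (isPullback_fiberSubobject hr _) ht).2 (Corel.rep_le_iff.2 le_rfl)
    · exact (fiberProduct_le_iff ht (isPullback_fiberSubobject hr _)).2 (Corel.le_rep_iff.2 le_rfl)

lemma Cospan.mobius_fiberSubobject [ExactCat A] [Maltsev A] [SubobjectFinite A]
    (t : Set.Iic w.toCorel) : mobius (fiberSubobject hr t) ⊤ = mobius t.1 w.toCorel := by
  have upward_closed : Set.Icc (fiberSubobject hr t) (fiberSubobject hr ⊤) ⊆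
      Set.range (fiberSubobject hr) := by
    rintro s ⟨hts, -⟩
    have h_le := MonoSpan.restrict_le_restrict_iff.2 hts
    obtain ⟨hfst, hsnd⟩ := (mem_range_fiberSubobject_iff hr).1 ⟨t, rfl⟩
    exact (mem_range_fiberSubobject_iff hr).2
      ⟨MonoSpan.surj_fst_of_le h_le hfst, MonoSpan.surj_snd_of_le h_le hsnd⟩
  calc mobius (fiberSubobject hr t) ⊤
      = mobius (fiberSubobject hr t) (fiberSubobject hr ⊤) := by rw [fiberSubobject_top]
    _ = mobius t ⊤ := mobius_orderEmbedding _ le_top upward_closed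
    _ = mobius t.1 w.toCorel :=
      (mobius_orderEmbedding (OrderEmbedding.subtype (· ∈ Set.Iic w.toCorel)) (a := t) le_top
        fun s hs => ⟨⟨s, hs.2⟩, rfl⟩).symm

end FiberProducts

section Calculus

variable {A : Type u} [Category.{v} A]

lemma surj_iff_forall_factors {x y : A} {f : x ⟶ y} :
    Surj f ↔ ∀ S : Subobject y, S.Factors f → S = ⊤ := by
  constructor
  · intro hf S hS
    exact (Subobject.isIso_arrow_iff_eq_top S).1 (hf _ _ (S.factorThru_arrow f hS))
  · intro hf z g m _ hgm
    exact (Subobject.isIso_iff_mk_eq_top m).2 (hf _ ((Subobject.mk_factors_iff _ _).2 ⟨g, hgm⟩))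

variable [RegularCat A] {K : Type w} [CommRing K] (δ : DegreeFunction A K) {x y z : A}

lemma T0.map_comp (f : x ⟶ y) (g : y ⟶ z) : T0.map δ (f ≫ g) = T0.map δ f ≫ T0.map δ g := by
  have map_eq {x y : A} (f : x ⟶ y) : T0.map δ f = spanHom δ (𝟙 x) f :=
    (spanHom_mono δ (graph f)).symm
  rw [map_eq, map_eq, map_eq]
  exact ((compHom_spanHom δ _ _ _ _ (IsPullback.id_horiz f)).trans (by simp)).symm

lemma T0.mapAdj_comp (f : x ⟶ y) (g : y ⟶ z) :
    T0.mapAdj δ (f ≫ g) = T0.mapAdj δ g ≫ T0.mapAdj δ f := by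
  have mapAdj_eq {x y : A} (f : x ⟶ y) : T0.mapAdj δ f = spanHom δ f (𝟙 x) :=
    (spanHom_mono δ (graphAdj f)).symm
  rw [mapAdj_eq, mapAdj_eq, mapAdj_eq]
  exact ((compHom_spanHom δ _ _ _ _ (IsPullback.id_horiz f).flip).trans (by simp)).symm

lemma T0.mapAdj_comp_map {t : A} (f : t ⟶ x) (g : t ⟶ y) :
    T0.mapAdj δ f ≫ T0.map δ g = spanHom δ f g := by
  have mapAdj_eq : T0.mapAdj δ f = spanHom δ f (𝟙 t) := (spanHom_mono δ (graphAdj f)).symm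
  have map_eq : T0.map δ g = spanHom δ (𝟙 t) g := (spanHom_mono δ (graph g)).symm
  rw [mapAdj_eq, map_eq]
  exact (compHom_spanHom δ _ _ _ _ (IsPullback.id_horiz (𝟙 t))).trans (by simp)

lemma T0.map_comp_mapAdj_of_isPullback {r : A} {p : r ⟶ x} {q : r ⟶ y} {a : x ⟶ z} {b : y ⟶ z}
    (h : IsPullback p q a b) : T0.map δ a ≫ T0.mapAdj δ b = T0.mapAdj δ p ≫ T0.map δ q := by
  rw [map_comp_mapAdj δ h, T0.mapAdj_comp_map]

lemma T0.map_comp_mapAdj_of_mono (m : x ⟶ y) [Mono m] : T0.map δ m ≫ T0.mapAdj δ m = 𝟙 _ :=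
  (T0.map_comp_mapAdj_of_isPullback δ (IsKernelPair.id_of_mono m)).trans (Category.id_comp _)

lemma T0.mapAdj_comp_map_of_surj {e : x ⟶ y} (he : Surj e) :
    T0.mapAdj δ e ≫ T0.map δ e = δ.deg e he • 𝟙 (T0.obj δ y) := by
  rw [T0.mapAdj_comp_map]
  calc spanHom δ e e = δ.deg e he • spanHom δ (𝟙 y) (𝟙 y) := by
        simpa only [Category.comp_id] using spanHom_precomp δ e he (𝟙 y) (𝟙 y)
    _ = δ.deg e he • 𝟙 (T0.obj δ y) := congrArg _ (spanHom_mono δ (graph (𝟙 y)))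

lemma proj_comm (u v : Subobject x) : proj δ u ≫ proj δ v = proj δ v ≫ proj δ u := by
  by_cases h : HasPullback u.arrow v.arrow
  · have h' : HasPullback v.arrow u.arrow := (IsPullback.of_hasPullback _ _).flip.hasPullback
    obtain ⟨m, hm, huv⟩ := exists_meet δ u v h
    obtain ⟨m', hm', hvu⟩ := exists_meet δ v u h'
    rw [huv, hvu, hm.unique (Set.pair_comm v u ▸ hm')]
  · rw [proj_comp_zero δ u v h, proj_comp_zero δ v u]
    exact fun h' => h (IsPullback.of_hasPullback v.arrow u.arrow).flip.hasPullback

variable [SubobjectFinite A]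

lemma pStar_eq_sum (x : A) [Fintype (Subobject x)] :
    pStar δ x = ∑ s : Subobject x, mobius s ⊤ • proj δ s :=
  finsum_eq_sum_of_fintype _

lemma proj_comp_pStar {v : Subobject x} (hv : v ≠ ⊤) : proj δ v ≫ pStar δ x = 0 := by
  cases nonempty_fintype (Subobject x)
  rw [← pStar_comp_proj δ v hv, pStar_eq_sum, Preadditive.sum_comp, Preadditive.comp_sum]
  exact Finset.sum_congr rfl fun u _ => by
    rw [Preadditive.comp_zsmul, Preadditive.zsmul_comp, proj_comm]

lemma pStar_comp_mapAdj {f : y ⟶ x} (hf : ¬ Surj f) : pStar δ x ≫ T0.mapAdj δ f = 0 := by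
  simp only [surj_iff_forall_factors, not_forall] at hf
  obtain ⟨S, hS, S_ne_top⟩ := hf
  have absorb : proj δ S ≫ T0.mapAdj δ S.arrow = T0.mapAdj δ S.arrow := by
    rw [proj, Category.assoc, T0.map_comp_mapAdj_of_mono, Category.comp_id]
  rw [← S.factorThru_arrow f hS, T0.mapAdj_comp, ← absorb, Category.assoc, ← Category.assoc,
    pStar_comp_proj δ S S_ne_top, zero_comp]

lemma map_comp_pStar {f : y ⟶ x} (hf : ¬ Surj f) : T0.map δ f ≫ pStar δ x = 0 := by
  simp only [surj_iff_forall_factors, not_forall] at hf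
  obtain ⟨S, hS, S_ne_top⟩ := hf
  have absorb : T0.map δ S.arrow ≫ proj δ S = T0.map δ S.arrow := by
    rw [proj, ← Category.assoc, T0.map_comp_mapAdj_of_mono, Category.id_comp]
  rw [← S.factorThru_arrow f hS, T0.map_comp, ← absorb, Category.assoc, Category.assoc,
    proj_comp_pStar δ S_ne_top, comp_zero, comp_zero]

lemma pStar_comp_map_comp_mapAdj {a : x ⟶ z} (ha : Surj a) {f : y ⟶ z} (hf : ¬ Surj f) :
    pStar δ x ≫ T0.map δ a ≫ T0.mapAdj δ f = 0 := by
  obtain ⟨r, p, q, h, -⟩ := RegularCat.surj_pullback a f ha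
  have hp : ¬ Surj p := fun hp => hf (Surj.of_comp (h.w ▸ hp.comp ha))
  rw [T0.map_comp_mapAdj_of_isPullback δ h, ← Category.assoc, pStar_comp_mapAdj δ hp, zero_comp]

lemma map_comp_mapAdj_comp_pStar {a : x ⟶ z} (ha : Surj a) {f : y ⟶ z} (hf : ¬ Surj f) :
    T0.map δ f ≫ T0.mapAdj δ a ≫ pStar δ x = 0 := by
  obtain ⟨r, p, q, h, -⟩ := RegularCat.surj_pullback a f ha
  have hp : ¬ Surj p := fun hp => hf (Surj.of_comp (h.w ▸ hp.comp ha))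
  rw [← Category.assoc, T0.map_comp_mapAdj_of_isPullback δ h.flip, Category.assoc,
    map_comp_pStar δ hp, comp_zero]

lemma comp_pStar_eq_self {X : T0 δ} {φ : X ⟶ T0.obj δ x}
    (hφ : ∀ v : Subobject x, v ≠ ⊤ → φ ≫ proj δ v = 0) : φ ≫ pStar δ x = φ := by
  cases nonempty_fintype (Subobject x)
  rw [pStar_eq_sum, Preadditive.comp_sum, Finset.sum_eq_single ⊤]
  · rw [Preadditive.comp_zsmul, mobius_self, one_smul, proj_top, Category.comp_id]
  · intro v _ hv
    rw [Preadditive.comp_zsmul, hφ v hv, smul_zero]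
  · exact fun h => absurd (Finset.mem_univ _) h

lemma mapAdj_comp_pStar_comp_map [Fintype (Subobject x)] (f : x ⟶ y) (g : x ⟶ z) :
    T0.mapAdj δ f ≫ pStar δ x ≫ T0.map δ g = ∑ s : Subobject x,
      mobius s ⊤ • (T0.mapAdj δ (s.arrow ≫ f) ≫ T0.map δ (s.arrow ≫ g)) := by
  rw [pStar_eq_sum, Preadditive.sum_comp, Preadditive.comp_sum]
  refine Finset.sum_congr rfl fun s _ => ?_
  rw [Preadditive.zsmul_comp, Preadditive.comp_zsmul, proj, T0.map_comp, T0.mapAdj_comp]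
  simp only [Category.assoc]

/-- Since `[e] p_x^* [e]^∨` kills all proper `p_v`, it does not change when composed with `p_y^*`,
and `p_y^*` in turn kills the summands of `p_x^*` whose image in `y` is proper. -/
lemma mapAdj_comp_pStar_comp_map_self {e : x ⟶ y} (he : Surj e) :
    T0.mapAdj δ e ≫ pStar δ x ≫ T0.map δ e = omega δ e • pStar δ y := by
  cases nonempty_fintype (Subobject x)
  have absorb : (T0.mapAdj δ e ≫ pStar δ x ≫ T0.map δ e) ≫ pStar δ y =
      T0.mapAdj δ e ≫ pStar δ x ≫ T0.map δ e := by
    refine comp_pStar_eq_self δ fun v hv => ?_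
    have hv' : ¬ Surj v.arrow := fun h =>
      hv (surj_iff_forall_factors.1 h v ((Subobject.factors_iff _ _).2 ⟨𝟙 _, Category.id_comp _⟩))
    have h := pStar_comp_map_comp_mapAdj δ he hv'
    simp only [proj, Category.assoc, reassoc_of% h, zero_comp, comp_zero]
  rw [← absorb, mapAdj_comp_pStar_comp_map, Preadditive.sum_comp, omega, finsum_eq_sum_of_fintype,
    Finset.sum_smul]
  refine Finset.sum_congr rfl fun s _ => ?_
  rw [Preadditive.zsmul_comp]
  split_ifs with hs
  · rw [T0.mapAdj_comp_map_of_surj δ hs, Linear.smul_comp, Category.id_comp, smul_assoc]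
  · rw [Category.assoc, map_comp_pStar δ hs, comp_zero, smul_zero, zero_smul]

end Calculus

section Composition

variable {A : Type u} [Category.{v} A]

lemma isPushout_epi_comp {x y z w t : A} (e : t ⟶ x) [Epi e] {p : x ⟶ y} {q : x ⟶ z}
    {a : y ⟶ w} {b : z ⟶ w} (h : IsPushout p q a b) : IsPushout (e ≫ p) (e ≫ q) a b := by
  have condition : ∀ s : PushoutCocone (e ≫ p) (e ≫ q), p ≫ s.inl = q ≫ s.inr := fun s => by
    simpa only [Category.assoc, cancel_epi] using s.condition
  exact ⟨⟨by rw [Category.assoc, h.w, Category.assoc]⟩,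
    ⟨PushoutCocone.IsColimit.mk _ (fun s => h.desc s.inl s.inr (condition s)) (by simp) (by simp)
      fun s m h_inl h_inr => h.hom_ext (by simp [h_inl]) (by simp [h_inr])⟩⟩

variable [RegularCat A] {x y z : A}

lemma spanImage_fst_surj {f : z ⟶ x} (hf : Surj f) (g : z ⟶ y) : Surj (spanImage f g).fst :=
  Surj.of_comp (f := toSpanImage f g) ((toSpanImage_fst f g).symm ▸ hf)

lemma spanImage_snd_surj (f : z ⟶ x) {g : z ⟶ y} (hg : Surj g) : Surj (spanImage f g).snd :=
  Surj.of_comp (f := toSpanImage f g) ((toSpanImage_snd f g).symm ▸ hg)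

variable [SubobjectFinite A] {K : Type w} [CommRing K] (δ : DegreeFunction A K)

lemma corelHomT0_extend {u v r : A} {a : x ⟶ u} {d : z ⟶ v} (ha : Surj a) (hd : Surj d)
    (t : Cospan A u v) {p : r ⟶ u} {q : r ⟶ v} (h : IsPullback p q t.left t.right) :
    corelHomT0 δ (t.extend a d ha hd) =
      pStar δ x ≫ T0.map δ a ≫ (T0.mapAdj δ p ≫ T0.map δ q) ≫ T0.mapAdj δ d ≫ pStar δ z := by
  rw [← T0.map_comp_mapAdj_of_isPullback δ h]
  simp only [corelHomT0, Cospan.extend, T0.map_comp, T0.mapAdj_comp, Category.assoc]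

lemma corelHomT0_comp_eq_omega_smul (u : Cospan A x y) (v : Cospan A y z) {r : A} {e : y ⟶ r}
    (he : Surj e) {p : r ⟶ u.obj} {q : r ⟶ v.obj} (hp : e ≫ p = u.right) (hq : e ≫ q = v.left) :
    corelHomT0 δ u ≫ corelHomT0 δ v = omega δ e • (pStar δ x ≫ T0.map δ u.left ≫
      (T0.mapAdj δ p ≫ pStar δ r ≫ T0.map δ q) ≫ T0.mapAdj δ v.right ≫ pStar δ z) := by
  have h_idem := pStar_idem δ y
  have h_omega := mapAdj_comp_pStar_comp_map_self δ he
  calc corelHomT0 δ u ≫ corelHomT0 δ v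
      = pStar δ x ≫ T0.map δ u.left ≫
          (T0.mapAdj δ p ≫ (T0.mapAdj δ e ≫ pStar δ y ≫ T0.map δ e) ≫ T0.map δ q) ≫
            T0.mapAdj δ v.right ≫ pStar δ z := by
        simp only [corelHomT0, ← hp, ← hq, T0.map_comp, T0.mapAdj_comp, Category.assoc,
          reassoc_of% h_idem]
    _ = _ := by simp only [h_omega, Linear.smul_comp, Linear.comp_smul]

/-- The subobjects of `r` without surjective legs are killed by `p_x^*` or `p_z^*`; the others are
the fibre products of the co-relations below `w`. -/
lemma pStar_sandwich_eq_sum [ExactCat A] [Maltsev A] {u v : A} {a : x ⟶ u} {d : z ⟶ v}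
    (ha : Surj a) (hd : Surj d) {r : MonoSpan A u v} {w : Cospan A u v}
    (hr : IsPullback r.fst r.snd w.left w.right) [Fintype (Set.Iic w.toCorel)] :
    pStar δ x ≫ T0.map δ a ≫ (T0.mapAdj δ r.fst ≫ pStar δ r.obj ≫ T0.map δ r.snd) ≫
        T0.mapAdj δ d ≫ pStar δ z =
      ∑ t : Set.Iic w.toCorel,
        mobius t.1 w.toCorel • corelHomT0 δ (t.1.rep.extend a d ha hd) := by
  cases nonempty_fintype (Subobject r.obj)
  rw [mapAdj_comp_pStar_comp_map]
  simp only [Preadditive.sum_comp, Preadditive.comp_sum, Preadditive.zsmul_comp,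
    Preadditive.comp_zsmul]
  symm
  refine Fintype.sum_of_injective _ (Cospan.fiberSubobject hr).injective _ _ (fun s hs => ?_)
    fun t => ?_
  · rw [Cospan.mem_range_fiberSubobject_iff, not_and_or] at hs
    rcases hs with hfst | hsnd
    · have h : pStar δ x ≫ T0.map δ a ≫ T0.mapAdj δ (s.arrow ≫ r.fst) = 0 :=
        pStar_comp_map_comp_mapAdj δ ha hfst
      rw [Category.assoc, reassoc_of% h, zero_comp, smul_zero]
    · have h : T0.map δ (s.arrow ≫ r.snd) ≫ T0.mapAdj δ d ≫ pStar δ z = 0 :=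
        map_comp_mapAdj_comp_pStar δ hd hsnd
      rw [Category.assoc, h, comp_zero, comp_zero, comp_zero, smul_zero]
  · rw [← Cospan.mobius_fiberSubobject hr,
      corelHomT0_extend δ ha hd _ (Cospan.isPullback_fiberSubobject hr t)]
    rfl

open Idempotents in
lemma corelHom_comp [ExactCat A] [Maltsev A] (u : Cospan A x y) (v : Cospan A y z)
    {r : MonoSpan A u.obj v.obj} {e : y ⟶ r.obj} (he : Surj e) (hfst : e ≫ r.fst = u.right)
    (hsnd : e ≫ r.snd = v.left) {w : Cospan A u.obj v.obj}
    (hr : IsPullback r.fst r.snd w.left w.right) :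
    corelHom δ u ≫ corelHom δ v =
      omega δ e • ∑ᶠ (t : Corel u.obj v.obj) (_ : t ≤ w.toCorel), mobius t w.toCorel •
        corelHom δ (t.rep.extend u.left v.right u.surj_left v.surj_right) := by
  cases nonempty_fintype (Set.Iic w.toCorel)
  have finsum_eq {M : Type _} [AddCommMonoid M] (F : Corel u.obj v.obj → M) :
      ∑ᶠ (t : Corel u.obj v.obj) (_ : t ≤ w.toCorel), F t = ∑ t : Set.Iic w.toCorel, F t :=
    (finsum_set_coe_eq_finsum_mem (Set.Iic w.toCorel)).symm.trans (finsum_eq_sum_of_fintype _)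
  refine Karoubi.hom_ext _ _ ?_
  rw [finsum_eq, karoubi_smul_f, Karoubi.sum_hom]
  simp only [Karoubi.zsmul_hom]
  calc corelHomT0 δ u ≫ corelHomT0 δ v = _ := corelHomT0_comp_eq_omega_smul δ u v he hfst hsnd
    _ = _ := by rw [pStar_sandwich_eq_sum δ u.surj_left v.surj_right hr]; rfl

end Composition

end TensorEnvelope

open TensorEnvelope in
theorem mainTheorem3 {A : Type u} [Category.{v} A] [RegularCat A] [ExactCat A] [Maltsev A]
    [SubobjectFinite A] {K : Type w} [CommRing K] (δ : DegreeFunction A K)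
    {x y z : A} (u : Cospan A x y) (v : Cospan A y z) :
    ∃ w : Cospan A u.obj v.obj,
      IsPushout u.right v.left w.left w.right ∧
      IsPullback (spanImage u.right v.left).fst (spanImage u.right v.left).snd w.left w.right ∧
      corelHom δ u ≫ corelHom δ v =
        omega δ (toSpanImage u.right v.left) •
          ∑ᶠ (t : Corel u.obj v.obj) (_ : t ≤ w.toCorel),
            mobius t w.toCorel •
              corelHom δ (t.rep.extend u.left v.right u.surj_left v.surj_right) := by
  have he := toSpanImage_surj u.right v.left
  have hfst := toSpanImage_fst u.right v.left
  have hsnd := toSpanImage_snd u.right v.left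
  obtain ⟨w, hw⟩ := (spanImage u.right v.left).exists_cospan_isPullback
    (spanImage_fst_surj u.surj_right v.left) (spanImage_snd_surj u.right v.surj_left)
  have := he.epi
  have h_pushout := isPushout_epi_comp (toSpanImage u.right v.left) (w.isPushout_of_isPullback hw)
  rw [hfst, hsnd] at h_pushout
  exact ⟨w, h_pushout, hw, corelHom_comp δ u v he hfst hsnd hw⟩
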